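/- Let $2\le p\le n-2$ and $\beta>0$. Let $\mathrm{St}(n,p)=\{X\in\mathbb R^{n\times p}: X^\top X=I_p\}$, with tangent spaces $T_X=\{\xi\in\mathbb R^{n\times p}: X^\top\xi+\xi^\top X=0\}$. Let $\mathrm{St}_\beta(n,p)$ be this manifold with the Riemannian metric which, for $Q\in\mathrm O(n)$ and $I_{n\times p}=\begin{bmatrix}I_p\\0\end{bmatrix}$, is given at $QI_{n\times p}$ by $$g\left(Q\begin{bmatrix}A_1\\H_1\end{bmatrix},Q\begin{bmatrix}A_2\\H_2\end{bmatrix}\right)=\beta\,\mathrm{tr}(A_1^\top A_2)+\mathrm{tr}(H_1^\top H_2)$$ for skew-symmetric $A_1,A_2\in\mathbb R^{p\times p}$ and arbitrary $H_1,H_2\in\mathbb R^{(n-p)\times p}$. Let $\mathrm{Exp}_X$ be its Riemannian exponential map at $X$. For a geodesic $\gamma$ with $\gamma(0)=X$, the point $\gamma(t)$ is called conjugate to $\gamma(0)$ along $\gamma$ if $t\gamma'(0)$ is a critical point of $\mathrm{Exp}_X$, i.e. if the derivative of $\mathrm{Exp}_X$ there is singular. The conjugate radius $\mathrm{conj}(X)$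 at $X$ is the supremum of the radii of the open balls centered at the origin of $T_X$ (for the norm given by $g$) that contain no critical point of $\mathrm{Exp}_X$; the conjugate radius of $\mathrm{St}_\beta(n,p)$ is $\inf_X\mathrm{conj}(X)$. Put $\alpha=\frac1{2\beta}-1$. Then the set $\{t>0:\frac{\sin t}{t}+(1+2\alpha)\cos t=0\}$ has a smallest element; denote it by $t^{\mathrm r}_\beta$. Let $Q\in\mathrm O(n)$ and $\xi=Q\begin{bmatrix}0\\H\end{bmatrix}\in T_{QI_{n\times p}}$, where $H=\begin{bmatrix}I_2&0\\0&0\end{bmatrix}\in\mathbb R^{(n-p)\times p}$. The geodesic $\gamma$ of $\mathrm{St}_\beta(n,p)$ with $\gamma(0)=QI_{n\times p}$ and $\gamma'(0)=\xi$ is $$\gamma(t)=Q\exp\left(t\begin{bmatrix}0&-H^\top\\H&0\end{bmatrix}\right)I_{n\times p},$$ and the following hold. 1. $\gamma(t^{\mathrm r}_\beta)$ and $\gamma(\pi)$ are conjugate to $\gamma(0)$ along $\gamma$. 2. $\gamma$ has constant speed $\sqrt2$, so that for all $T>0$ its length between $t=0$ and $t=T$ is $T\sqrt2$. 3. At every point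 of $\mathrm{St}_\beta(n,p)$ the conjugate radius is at most $\sqrt2\,\min\{t^{\mathrm r}_\beta,\pi\}$; hence so is the conjugate radius of $\mathrm{St}_\beta(n,p)$. 4. The minimum equals $t^{\mathrm r}_\beta$ when $\beta\le1$ and $\pi$ when $\beta\ge1$. -/

import Mathlib

open scoped Matrix ContDiff ENNReal NNReal

/- Spaces of real matrices carry the ℓ^∞ operator norm. It only serves to speak of derivatives
and smoothness, which do not depend on the choice of a norm in finite dimension. -/
open scoped Matrix.Norms.Operator

noncomputable section

namespace StiefelConj

section Riemannian

variable {E : Type*} [NormedAddCommGroup E] [NormedSpace ℝ E]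

/-- Christoffel symbols of the first kind of a metric `g` on (an open set of) a vector space `E`:
`Γ_x(u, v; w) = ½ (D_u g(v, w) + D_v g(u, w) - D_w g(u, v))`, so that the Levi-Civita connection
satisfies `g(∇_u V, w) = g(D_u V, w) + Γ(u, V; w)`. -/
def christoffel (g : E → E → E → ℝ) (x u v w : E) : ℝ :=
  (1 / 2) * (fderiv ℝ (fun y => g y v w) x u + fderiv ℝ (fun y => g y u w) x v
    - fderiv ℝ (fun y => g y u v) x w)

/-- `γ : ℝ → E` is a geodesic of the submanifold `M` of `E`, with tangent spaces `T x`, for the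
Riemannian metric that `g` restricts to on `M`: it is smooth, runs in `M`, and its covariant
acceleration `∇_{γ'} γ'` for the Levi-Civita connection of `M` vanishes. The latter is the
tangential part of the covariant acceleration with respect to `g` on a neighbourhood of `M`,
hence it vanishes iff the pairing below is zero for all tangent vectors `η`
(this condition depends on `g` through the inner products on the tangent spaces of `M` only). -/
structure IsGeodesic (g : E → E → E → ℝ) (M : Set E) (T : E → Submodule ℝ E)
    (γ : ℝ → E) : Prop where
  smooth : ContDiff ℝ ∞ γ
  mem : ∀ t, γ t ∈ M
  geodesic_eq : ∀ t, ∀ η ∈ T (γ t),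
    g (γ t) (deriv (deriv γ) t) η + christoffel g (γ t) (deriv γ t) (deriv γ t) η = 0

/-- The norm of the tangent vector `ξ` at `x`. -/
def metricNorm (g : E → E → E → ℝ) (x ξ : E) : ℝ := √(g x ξ ξ)

/-- The length of `γ` between the times `a` and `b`. -/
def curveLength (g : E → E → E → ℝ) (γ : ℝ → E) (a b : ℝ) : ℝ :=
  ∫ t in a..b, metricNorm g (γ t) (deriv γ t)

open Classical in
/-- The Riemannian exponential `Exp_x : T_x M → M`, `ξ ↦ γ_ξ(1)`, where `γ_ξ` is the geodesic with
`γ_ξ(0) = x` and `γ_ξ'(0) = ξ` (for a complete `M` it exists and is unique; `0` is a dummy value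
otherwise). -/
def riemExp (g : E → E → E → ℝ) (M : Set E) (T : E → Submodule ℝ E) (x : E) (ξ : T x) : E :=
  if h : ∃ γ : ℝ → E, IsGeodesic g M T γ ∧ γ 0 = x ∧ deriv γ 0 = (ξ : E) then
    Classical.choose h 1
  else 0

/-- `v ∈ T_x M` is a critical point of `Exp_x`: the derivative of `Exp_x` at `v` exists and is
singular. It maps `T_x M` to a tangent space of `M` of the same dimension, so singular means
not injective. -/
def IsCriticalPoint (g : E → E → E → ℝ) (M : Set E) (T : E → Submodule ℝ E) (x : E)
    (v : T x) : Prop :=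
  ∃ L : T x →L[ℝ] E, HasFDerivAt (riemExp g M T x) L v ∧ ¬ Function.Injective L

/-- `γ` is a geodesic and `γ(t)` is conjugate to `γ(0)` along `γ`: the vector `t γ'(0)` is a
critical point of `Exp_{γ(0)}`. -/
def IsConjugateAlong (g : E → E → E → ℝ) (M : Set E) (T : E → Submodule ℝ E) (γ : ℝ → E)
    (t : ℝ) : Prop :=
  IsGeodesic g M T γ ∧
    ∃ v : T (γ 0), (v : E) = t • deriv γ 0 ∧ IsCriticalPoint g M T (γ 0) v

/-- The conjugate radius at `x`: the supremum of the radii `r` of open balls centered at the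
origin of `T_x M` that contain no critical point of `Exp_x`. -/
def conjRadiusAt (g : E → E → E → ℝ) (M : Set E) (T : E → Submodule ℝ E) (x : E) : ℝ≥0∞ :=
  ⨆ (r : ℝ≥0) (_ : ∀ v : T x, metricNorm g x (v : E) < r → ¬ IsCriticalPoint g M T x v),
    (r : ℝ≥0∞)

/-- The conjugate radius of `M`: the infimum of the conjugate radii at its points. -/
def conjRadius (g : E → E → E → ℝ) (M : Set E) (T : E → Submodule ℝ E) : ℝ≥0∞ :=
  ⨅ x ∈ M, conjRadiusAt g M T x

end Riemannian

section Stiefel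

variable {n p : ℕ}

/-- The Stiefel manifold of orthonormal `p`-frames in `ℝⁿ`. -/
def stiefel (n p : ℕ) : Set (Matrix (Fin n) (Fin p) ℝ) := {X | Xᵀ * X = 1}

/-- The tangent space to the Stiefel manifold at `X`. -/
def tangent (X : Matrix (Fin n) (Fin p) ℝ) : Submodule ℝ (Matrix (Fin n) (Fin p) ℝ) where
  carrier := {ξ | Xᵀ * ξ + ξᵀ * X = 0}
  zero_mem' := by simp
  add_mem' := by
    intro a b ha hb
    simp only [Set.mem_ofPred_eq, Matrix.mul_add, Matrix.transpose_add, Matrix.add_mul] at *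
    rw [add_add_add_comm, ha, hb, add_zero]
  smul_mem' := by
    intro c a ha
    simp only [Set.mem_ofPred_eq, Matrix.mul_smul, Matrix.transpose_smul, Matrix.smul_mul] at *
    rw [← smul_add, ha, smul_zero]

/-- The metric `g` of `St_β(n, p)`. For `X` in the Stiefel manifold and tangent vectors
`ξ = X A + X_⊥ H`, `η = X B + X_⊥ K` it is `β tr(Aᵀ B) + tr(Hᵀ K)`, because `A = Xᵀ ξ`,
`B = Xᵀ η` and `X_⊥ X_⊥ᵀ = 1 - X Xᵀ`; see `metric_apply` below. -/
def metric (β : ℝ) (X ξ η : Matrix (Fin n) (Fin p) ℝ) : ℝ :=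
  β * ((Xᵀ * ξ)ᵀ * (Xᵀ * η)).trace + (ξᵀ * (1 - X * Xᵀ) * η).trace

/-- The index set `{1, …, n}` cut into its first `p` and its last `n - p` elements. -/
def split (h : p ≤ n) : Fin p ⊕ Fin (n - p) ≃ Fin n :=
  finSumFinEquiv.trans (finCongr (Nat.add_sub_of_le h))

/-- The block matrix `[A; H]`. -/
def stack (h : p ≤ n) (A : Matrix (Fin p) (Fin p) ℝ) (H : Matrix (Fin (n - p)) (Fin p) ℝ) :
    Matrix (Fin n) (Fin p) ℝ :=
  Matrix.reindex (split h) (Equiv.refl _) (Matrix.fromRows A H)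

/-- The matrix `I_{n×p} = [I_p; 0]`. -/
def frame (h : p ≤ n) : Matrix (Fin n) (Fin p) ℝ := stack h 1 0

/-- The block matrix `[2βA, -Hᵀ; H, 0]`. -/
def omega (h : p ≤ n) (β : ℝ) (A : Matrix (Fin p) (Fin p) ℝ)
    (H : Matrix (Fin (n - p)) (Fin p) ℝ) : Matrix (Fin n) (Fin n) ℝ :=
  Matrix.reindex (split h) (split h) (Matrix.fromBlocks ((2 * β) • A) (-Hᵀ) H 0)

/-- The block matrix `[I_2, 0; 0, 0]` of size `(n - p) × p`. -/
def hMat (n p : ℕ) : Matrix (Fin (n - p)) (Fin p) ℝ :=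
  Matrix.of fun i j => if (i : ℕ) = (j : ℕ) ∧ (j : ℕ) < 2 then 1 else 0

/-- The positive solutions of `sin t / t + (1 + 2α) cos t = 0`, where `α = 1 / (2β) - 1`. -/
def rootSet (β : ℝ) : Set ℝ :=
  {t | 0 < t ∧ Real.sin t / t + (1 + 2 * (1 / (2 * β) - 1)) * Real.cos t = 0}

/-- The smallest element of `rootSet β`. -/
def tRoot (β : ℝ) : ℝ := sInf (rootSet β)

theorem frame_eq (h : p ≤ n) :
    (frame h : Matrix (Fin n) (Fin p) ℝ)ᵀ =
      (Matrix.fromCols 1 0).submatrix id (split h).symm := by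
  ext i j
  rcases hj : (split h).symm j with k | k <;>
    simp [frame, stack, hj, Matrix.one_apply, eq_comm]

/-- The metric in the coordinates `ξ = Q [A; H]` of the tangent space at `Q I_{n×p}`. -/
theorem metric_apply (h : p ≤ n) (β : ℝ) (Q : Matrix (Fin n) (Fin n) ℝ)
    (hQ : Q ∈ Matrix.orthogonalGroup (Fin n) ℝ) (A B : Matrix (Fin p) (Fin p) ℝ)
    (H K : Matrix (Fin (n - p)) (Fin p) ℝ) :
    metric β (Q * frame h) (Q * stack h A H) (Q * stack h B K) =
      β * (Aᵀ * B).trace + (Hᵀ * K).trace := by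
  have hQ' : Qᵀ * Q = 1 := by
    have := (Matrix.mem_orthogonalGroup_iff' (Fin n) ℝ).1 hQ
    simpa [Matrix.star_eq_conjTranspose] using this
  have key (C : Matrix (Fin p) (Fin p) ℝ) (L : Matrix (Fin (n - p)) (Fin p) ℝ) :
      (Q * frame h)ᵀ * (Q * stack h C L) = C := by
    rw [Matrix.transpose_mul, Matrix.mul_assoc, ← Matrix.mul_assoc Qᵀ, hQ', Matrix.one_mul,
      frame_eq, stack, Matrix.reindex_apply, Matrix.submatrix_mul_equiv,
      Matrix.fromCols_mul_fromRows]
    ext i j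
    simp
  have key2 : (Q * stack h A H)ᵀ * (Q * stack h B K) = Aᵀ * B + Hᵀ * K := by
    rw [Matrix.transpose_mul, Matrix.mul_assoc, ← Matrix.mul_assoc Qᵀ, hQ', Matrix.one_mul,
      stack, stack, Matrix.reindex_apply, Matrix.reindex_apply, Matrix.transpose_submatrix,
      Matrix.submatrix_mul_equiv, Matrix.transpose_fromRows, Matrix.fromCols_mul_fromRows]
    ext i j
    simp
  have key3 : (Q * stack h A H)ᵀ * (Q * frame h) = Aᵀ := by
    rw [← Matrix.transpose_transpose (Q * frame h), ← Matrix.transpose_mul, key]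
  rw [metric, key, key, Matrix.mul_sub, Matrix.sub_mul, Matrix.mul_one, key2,
    ← Matrix.mul_assoc _ (Q * frame h), key3, Matrix.mul_assoc, key]
  simp

end Stiefel

end StiefelConj

end

/-! The geodesic through `X` with velocity `ξ` is `t ↦ exp(tG) X exp(t(1 - 2β)Xᵀξ)`, where the
skew-symmetric matrix `G` depends linearly on `ξ`; uniqueness for the geodesic equation therefore
gives a closed formula for `Exp_X`. If `Xᵀξ = 0` then `G = ξXᵀ - Xξᵀ`, and if moreover
`ξξᵀξ = ξ` then `G³ = -G`. For a skew-symmetric `J` with `ξᵀξJ = J`, the images under `ζ ↦ G` of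
the tangent vectors `XJ` and `ξJ` split into parts that commute and parts that anticommute with
`ξXᵀ - Xξᵀ`; on both the derivative of `exp` is explicit. In terms of the basis `XJ`, `ξJ` of a
plane in `T_X`, the derivative of `Exp_X` at `tξ` is triangular with diagonal entries
`(1 - β) cos t + β sinc t` and `sinc t`, which vanish on `rootSet β` and at `π` respectively.
The block `I_2` of `H` leaves room for such a `J ≠ 0`, namely the rotation of the first two
coordinates. Every point of the manifold has the form `Q I_{n×p}`, so the bound holds everywhere.
-/

namespace StiefelConj

theorem sinc_pi : Real.sinc Real.pi = 0 := by
  rw [Real.sinc_of_ne_zero Real.pi_ne_zero, Real.sin_pi, zero_div]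

section RootSet

variable {β t : ℝ}

/-- The defining function of `rootSet β`, cleared of the denominators `β` and `t`; it is continuous
on all of `ℝ`, which gives the existence of the smallest root. -/
noncomputable def rootFun (β t : ℝ) : ℝ := β * Real.sin t + (1 - β) * (t * Real.cos t)

theorem continuous_rootFun (β : ℝ) : Continuous (rootFun β) := by
  unfold rootFun
  fun_prop

theorem mem_rootSet_iff (hβ : β ≠ 0) : t ∈ rootSet β ↔ 0 < t ∧ rootFun β t = 0 := by
  refine and_congr_right fun ht => ?_
  have h : Real.sin t / t + (1 + 2 * (1 / (2 * β) - 1)) * Real.cos t = rootFun β t / (β * t) := by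
    rw [rootFun]
    field_simp
    ring
  rw [h, div_eq_zero_iff, or_iff_left (mul_ne_zero hβ ht.ne')]

theorem mul_cos_lt_sin (ht : 0 < t) (htπ : t < Real.pi) : t * Real.cos t < Real.sin t := by
  rcases lt_or_ge t (Real.pi / 2) with h | h
  · have hcos : 0 < Real.cos t := Real.cos_pos_of_mem_Ioo ⟨by linarith, h⟩
    rw [← lt_div_iff₀ hcos, ← Real.tan_eq_sin_div_cos]
    exact Real.lt_tan ht h
  · have hcos : Real.cos t ≤ 0 := Real.cos_nonpos_of_pi_div_two_le_of_le h (by linarith)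
    exact (mul_nonpos_of_nonneg_of_nonpos ht.le hcos).trans_lt (Real.sin_pos_of_pos_of_lt_pi ht htπ)

theorem rootFun_pos_of_le_pi_div_two (hβ : 0 < β) (ht : 0 < t) (htπ : t ≤ Real.pi / 2) :
    0 < rootFun β t := by
  have hcos : 0 ≤ t * Real.cos t :=
    mul_nonneg ht.le (Real.cos_nonneg_of_mem_Icc ⟨by linarith, htπ⟩)
  have hlt : t * Real.cos t < Real.sin t := mul_cos_lt_sin ht (by linarith [Real.pi_pos])
  rw [rootFun]
  linarith [mul_lt_mul_of_pos_left hlt hβ]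

theorem rootFun_pos_of_one_le (hβ : 1 ≤ β) (ht : 0 < t) (htπ : t < Real.pi) :
    0 < rootFun β t := by
  have hsin : 0 < Real.sin t := Real.sin_pos_of_pos_of_lt_pi ht htπ
  rw [rootFun]
  linarith [mul_le_mul_of_nonneg_left (mul_cos_lt_sin ht htπ).le (sub_nonneg.2 hβ)]

theorem exists_mem_rootSet_le (hβ : 0 < β) {b : ℝ} (hb : Real.pi / 2 ≤ b) (h : rootFun β b ≤ 0) :
    ∃ t ∈ rootSet β, t ≤ b := by
  obtain ⟨t, ht, h0⟩ := intermediate_value_Icc' hb (continuous_rootFun β).continuousOn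
    ⟨h, (rootFun_pos_of_le_pi_div_two hβ Real.pi_div_two_pos le_rfl).le⟩
  exact ⟨t, (mem_rootSet_iff hβ.ne').2 ⟨Real.pi_div_two_pos.trans_le ht.1, h0⟩, ht.2⟩

theorem isClosed_rootSet (hβ : 0 < β) : IsClosed (rootSet β) := by
  have h : rootSet β = Set.Ici (Real.pi / 2) ∩ rootFun β ⁻¹' {0} := by
    ext t
    rw [mem_rootSet_iff hβ.ne']
    refine and_congr_left fun h0 => ⟨fun ht => ?_, Real.pi_div_two_pos.trans_le⟩
    exact le_of_not_gt fun hlt => (rootFun_pos_of_le_pi_div_two hβ ht hlt.le).ne' h0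
  rw [h]
  exact isClosed_Ici.inter (isClosed_singleton.preimage (continuous_rootFun β))

theorem isLeast_tRoot (hβ : 0 < β) : IsLeast (rootSet β) (tRoot β) := by
  have hbdd : BddBelow (rootSet β) := ⟨0, fun t ht => ht.1.le⟩
  have hneg : rootFun β (Real.pi / 2 + Real.pi) ≤ 0 := by
    simp [rootFun, Real.sin_add_pi, Real.cos_add_pi, hβ.le]
  obtain ⟨t, ht, -⟩ := exists_mem_rootSet_le hβ (by linarith [Real.pi_pos]) hneg
  exact (isClosed_rootSet hβ).isLeast_csInf ⟨t, ht⟩ hbdd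

theorem tRoot_le_pi (hβ : 0 < β) (hβ1 : β ≤ 1) : tRoot β ≤ Real.pi := by
  have h : rootFun β Real.pi ≤ 0 := by
    simpa [rootFun] using mul_nonneg (sub_nonneg.2 hβ1) Real.pi_pos.le
  obtain ⟨t, ht, htπ⟩ := exists_mem_rootSet_le hβ (by linarith [Real.pi_pos]) h
  exact ((isLeast_tRoot hβ).2 ht).trans htπ

theorem pi_le_tRoot (hβ : 1 ≤ β) : Real.pi ≤ tRoot β := by
  have hβ0 : 0 < β := by linarith
  obtain ⟨ht, h0⟩ := (mem_rootSet_iff hβ0.ne').1 (isLeast_tRoot hβ0).1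
  exact le_of_not_gt fun hlt => (rootFun_pos_of_one_le hβ ht hlt).ne' h0

end RootSet

section Calculus

variable {E : Type*} [NormedAddCommGroup E] [NormedSpace ℝ E]

theorem eq_of_hasDerivAt_of_eq {F : E → E} (hF : ContDiff ℝ 1 F) {f g : ℝ → E}
    (hf : ∀ t, HasDerivAt f (F (f t)) t) (hg : ∀ t, HasDerivAt g (F (g t)) t) {t₀ : ℝ}
    (h₀ : f t₀ = g t₀) : f = g := by
  have hfc : Continuous f := continuous_iff_continuousAt.2 fun t => (hf t).continuousAt
  have hgc : Continuous g := continuous_iff_continuousAt.2 fun t => (hg t).continuousAt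
  have hopen : IsOpen {t | f t = g t} := by
    refine isOpen_iff_mem_nhds.2 fun t (ht : f t = g t) => ?_
    obtain ⟨K, s, hs, hlip⟩ := (hF.contDiffAt (x := f t)).exists_lipschitzOnWith
    refine ODE_solution_unique_of_eventually (v := fun _ => F) (s := fun _ => s)
      (Filter.Eventually.of_forall fun _ => hlip) ?_ ?_ ht
    · filter_upwards [hfc.continuousAt hs] with r hr using ⟨hf r, hr⟩
    · filter_upwards [hgc.continuousAt (ht ▸ hs)] with r hr using ⟨hg r, hr⟩
  have huniv := IsClopen.eq_univ ⟨isClosed_eq hfc hgc, hopen⟩ ⟨t₀, h₀⟩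
  exact funext (Set.eq_univ_iff_forall.1 huniv)

variable {l m n : Type*}

theorem isBoundedBilinearMap_matrix_mul [Fintype l] [Fintype m] [Fintype n] :
    IsBoundedBilinearMap ℝ fun q : Matrix l m ℝ × Matrix m n ℝ => q.1 * q.2 where
  add_left := Matrix.add_mul
  smul_left := Matrix.smul_mul
  add_right := Matrix.mul_add
  smul_right a A B := Matrix.mul_smul A a B
  bound := ⟨1, one_pos, fun A B => by simpa using Matrix.linfty_opNorm_mul A B⟩

/-- Transposition as a continuous linear map, through which derivatives pass. -/
noncomputable def transposeCLM [Finite m] [Finite n] : Matrix m n ℝ →L[ℝ] Matrix n m ℝ :=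
  LinearMap.toContinuousLinearMap (Matrix.transposeLinearEquiv m n ℝ ℝ).toLinearMap

theorem hasDerivAt_matrix_mul [Finite l] [Fintype m] [Finite n] {f : ℝ → Matrix l m ℝ}
    {g : ℝ → Matrix m n ℝ} {f' g'} {t : ℝ} (hf : HasDerivAt f f' t) (hg : HasDerivAt g g' t) :
    HasDerivAt (fun s => f s * g s) (f t * g' + f' * g t) t := by
  cases nonempty_fintype l
  cases nonempty_fintype n
  have h := (isBoundedBilinearMap_matrix_mul.hasFDerivAt (f t, g t)).comp_hasDerivAt t
    (hf.prodMk hg)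
  rwa [isBoundedBilinearMap_matrix_mul.deriv_apply] at h

theorem hasDerivAt_matrix_transpose [Finite l] [Finite m] {f : ℝ → Matrix l m ℝ} {f'} {t : ℝ}
    (hf : HasDerivAt f f' t) : HasDerivAt (fun s => (f s)ᵀ) f'ᵀ t := by
  cases nonempty_fintype l
  cases nonempty_fintype m
  exact (transposeCLM (m := l) (n := m)).hasFDerivAt.comp_hasDerivAt t hf

variable [Fintype l] [Fintype m] [Fintype n]

@[fun_prop]
theorem contDiff_matrix_mul {k : WithTop ℕ∞} {f : E → Matrix l m ℝ} {g : E → Matrix m n ℝ}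
    (hf : ContDiff ℝ k f) (hg : ContDiff ℝ k g) : ContDiff ℝ k fun x => f x * g x :=
  (isBoundedBilinearMap_matrix_mul (l := l) (m := m) (n := n)).contDiff.comp (hf.prodMk hg)

@[fun_prop]
theorem contDiff_matrix_transpose {k : WithTop ℕ∞} {f : E → Matrix l m ℝ}
    (hf : ContDiff ℝ k f) : ContDiff ℝ k fun x => (f x)ᵀ :=
  (transposeCLM (m := l) (n := m)).contDiff.comp hf

end Calculus

section Exponential

open NormedSpace

attribute [local instance] LieRing.ofAssociativeRing LieAlgebra.ofAssociativeAlgebra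

variable {𝔸 : Type*} [NormedRing 𝔸] [NormedAlgebra ℝ 𝔸] [CompleteSpace 𝔸]

@[fun_prop]
theorem contDiff_exp {k : WithTop ℕ∞} : ContDiff ℝ k (exp : 𝔸 → 𝔸) :=
  contDiff_iff_contDiffAt.2 fun x => (exp_analytic (𝕂 := ℝ) x).contDiffAt

theorem hasFDerivAt_exp (x : 𝔸) : HasFDerivAt exp (fderiv ℝ exp x) x :=
  (contDiff_exp.differentiable one_ne_zero x).hasFDerivAt

theorem exp_smul_of_cube_eq_neg {x : 𝔸} (hx : x * x * x = -x) (t : ℝ) :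
    exp (t • x) = 1 + Real.sin t • x + (1 - Real.cos t) • (x * x) := by
  refine congrFun (eq_of_hasDerivAt_of_eq (F := fun y : 𝔸 => y * x) (by fun_prop)
    (g := fun s => 1 + Real.sin s • x + (1 - Real.cos s) • (x * x))
    (hasDerivAt_exp_smul_const x) (fun s => ?_) (t₀ := 0) (by simp)) t
  have h := (((Real.hasDerivAt_sin s).smul_const x).const_add 1).fun_add
    (((Real.hasDerivAt_cos s).const_sub 1).smul_const (x * x))
  convert h using 1
  simp only [add_mul, one_mul, smul_mul_assoc, hx]
  module

theorem fderiv_exp_of_commute {x y : 𝔸} (h : Commute x y) : fderiv ℝ exp x y = exp x * y := by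
  let _ : NormedAlgebra ℚ 𝔸 := NormedAlgebra.restrictScalars ℚ ℝ 𝔸
  have hline : HasLineDerivAt ℝ exp (exp x * y) x y := by
    have hexp := (hasDerivAt_exp_smul_const (𝕂 := ℝ) y 0).const_mul (exp x)
    rw [zero_smul, exp_zero, one_mul] at hexp
    exact hexp.congr_of_eventuallyEq
      (Filter.Eventually.of_forall fun s => exp_add_of_commute (h.smul_right s))
  exact ((hasFDerivAt_exp x).hasLineDerivAt y).unique hline

theorem exp_exp_conj (x y : 𝔸) : exp (exp (-y) * x * exp y) = exp (-y) * exp x * exp y := by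
  let _ : NormedAlgebra ℚ 𝔸 := NormedAlgebra.restrictScalars ℚ ℝ 𝔸
  let _ : Invertible (exp y) := invertibleExp y
  exact exp_units_conj' (unitOfInvertible (exp y)) x

theorem hasDerivAt_exp_conj (x y : 𝔸) :
    HasDerivAt (fun s : ℝ => exp (-(s • y)) * x * exp (s • y)) ⁅x, y⁆ 0 := by
  have hneg := hasDerivAt_exp_smul_const (𝕂 := ℝ) (-y) 0
  have hpos := hasDerivAt_exp_smul_const (𝕂 := ℝ) y 0
  simpa [Ring.lie_def, sub_eq_add_neg, add_comm] using (hneg.mul_const x).fun_mul hpos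

/-- Both sides differentiate `s ↦ exp (exp (-s y) x exp (s y)) = exp (-s y) exp x exp (s y)`. -/
theorem fderiv_exp_lie (x y : 𝔸) : fderiv ℝ exp x ⁅x, y⁆ = ⁅exp x, y⁆ := by
  have hcomp := (hasFDerivAt_exp x).comp_hasDerivAt_of_eq 0 (hasDerivAt_exp_conj x y) (by simp)
  have hconj := hasDerivAt_exp_conj (exp x) y
  simp only [← exp_exp_conj] at hconj
  exact hcomp.unique hconj

theorem fderiv_exp_smul_of_anticommute {s m : 𝔸} (hs : s * s * s = -s) (hsm : m * s = -(s * m))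
    (hm : s * s * m = -m) (t : ℝ) : fderiv ℝ exp (t • s) m = Real.sinc t • m := by
  rcases eq_or_ne t 0 with rfl | ht
  · rw [zero_smul, fderiv_exp_of_commute (Commute.zero_left m)]
    simp
  · have hlie : ⁅s, s * m⁆ = (-2 : ℝ) • m := by
      rw [Ring.lie_def, mul_assoc s m s, hsm, mul_neg, ← mul_assoc, hm]
      module
    have hlie_sq : ⁅s * s, s * m⁆ = 0 := by
      have hcomm : m * (s * s) = s * s * m := by
        rw [← mul_assoc, hsm, neg_mul, mul_assoc, hsm, mul_neg, neg_neg, mul_assoc]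
      rw [Ring.lie_def, mul_assoc s m, hcomm]
      simp only [mul_assoc, sub_self]
    have hm_lie : m = ⁅t • s, (-(2 * t)⁻¹) • (s * m)⁆ := by
      rw [smul_lie, lie_smul, hlie, smul_smul, smul_smul]
      field_simp
      simp
    rw [hm_lie, fderiv_exp_lie, ← hm_lie, exp_smul_of_cube_eq_neg hs, lie_smul, add_lie, add_lie,
      smul_lie, smul_lie, hlie, hlie_sq, (Commute.one_left (s * m)).lie_eq, Real.sinc_of_ne_zero ht]
    match_scalars
    field_simp

end Exponential

section Tangent

variable {n p : ℕ} {X ξ : Matrix (Fin n) (Fin p) ℝ}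

theorem mem_stiefel : X ∈ stiefel n p ↔ Xᵀ * X = 1 := Iff.rfl

theorem mem_tangent : ξ ∈ tangent X ↔ (Xᵀ * ξ)ᵀ = -(Xᵀ * ξ) := by
  rw [eq_neg_iff_add_eq_zero, add_comm, Matrix.transpose_mul, Matrix.transpose_transpose]
  rfl

theorem mem_tangent_of_hasDerivAt {γ : ℝ → Matrix (Fin n) (Fin p) ℝ} (hγ : ∀ t, γ t ∈ stiefel n p)
    {t : ℝ} (h : HasDerivAt γ ξ t) : ξ ∈ tangent (γ t) := by
  have hmul := hasDerivAt_matrix_mul (hasDerivAt_matrix_transpose h) h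
  rw [show (fun s => (γ s)ᵀ * γ s) = fun _ => 1 from funext hγ] at hmul
  exact hmul.unique (hasDerivAt_const t 1)

end Tangent

section Trace

open Matrix

variable {l m R : Type*} [Fintype l] [Fintype m]

theorem trace_mul_eq_zero_of_transpose_eq_neg [CommRing R] [NoZeroDivisors R] [CharZero R]
    {S K : Matrix m m R} (hS : Sᵀ = S) (hK : Kᵀ = -K) : (S * K).trace = 0 := by
  refine CharZero.eq_neg_self_iff.1 ?_
  rw [← trace_neg, ← Matrix.mul_neg, ← hK, ← trace_transpose_mul, hS]

theorem trace_transpose_mul_self_nonneg (Z : Matrix l m ℝ) : 0 ≤ (Zᵀ * Z).trace := by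
  simpa using (posSemidef_conjTranspose_mul_self Z).trace_nonneg

theorem trace_transpose_mul_self_eq_zero {Z : Matrix l m ℝ} : (Zᵀ * Z).trace = 0 ↔ Z = 0 := by
  simpa using trace_conjTranspose_mul_self_eq_zero_iff (A := Z)

theorem hasDerivAt_matrix_trace {f : ℝ → Matrix m m ℝ} {f'} {t : ℝ} (hf : HasDerivAt f f' t) :
    HasDerivAt (fun s => (f s).trace) f'.trace t :=
  (LinearMap.toContinuousLinearMap (traceLinearMap m ℝ ℝ)).hasFDerivAt.comp_hasDerivAt t hf

@[fun_prop]
theorem contDiff_matrix_trace {E : Type*} [NormedAddCommGroup E] [NormedSpace ℝ E]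
    {k : WithTop ℕ∞} {f : E → Matrix m m ℝ} (hf : ContDiff ℝ k f) :
    ContDiff ℝ k fun x => (f x).trace :=
  (LinearMap.toContinuousLinearMap (traceLinearMap m ℝ ℝ)).contDiff.comp hf

end Trace

section Metric

open Matrix

variable {n p : ℕ} {β : ℝ} {X ξ η : Matrix (Fin n) (Fin p) ℝ}

theorem metric_eq (β : ℝ) (X ξ η : Matrix (Fin n) (Fin p) ℝ) :
    metric β X ξ η = (ξᵀ * η).trace + (β - 1) * ((Xᵀ * ξ)ᵀ * (Xᵀ * η)).trace := by
  simp only [metric, transpose_mul, transpose_transpose, Matrix.mul_sub, Matrix.sub_mul,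
    Matrix.mul_one, trace_sub, Matrix.mul_assoc]
  ring

theorem metric_sub_left (β : ℝ) (X ξ ζ η : Matrix (Fin n) (Fin p) ℝ) :
    metric β X (ξ - ζ) η = metric β X ξ η - metric β X ζ η := by
  simp only [metric_eq, Matrix.mul_sub, transpose_sub, Matrix.sub_mul, trace_sub]
  ring

theorem metric_self (hX : X ∈ stiefel n p) :
    metric β X ξ ξ = β * ((Xᵀ * ξ)ᵀ * (Xᵀ * ξ)).trace +
      ((ξ - X * (Xᵀ * ξ))ᵀ * (ξ - X * (Xᵀ * ξ))).trace := by
  have hproj : Xᵀ * (ξ - X * (Xᵀ * ξ)) = 0 := by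
    rw [Matrix.mul_sub, ← Matrix.mul_assoc, mem_stiefel.1 hX, Matrix.one_mul, sub_self]
  rw [metric, transpose_sub, Matrix.sub_mul, transpose_mul X, Matrix.mul_assoc _ Xᵀ, hproj,
    Matrix.mul_zero, sub_zero, Matrix.mul_assoc, Matrix.sub_mul, Matrix.one_mul, Matrix.mul_assoc]

theorem eq_zero_of_metric_self_eq_zero (hβ : 0 < β) (hX : X ∈ stiefel n p)
    (h : metric β X ξ ξ = 0) : ξ = 0 := by
  rw [metric_self hX, add_eq_zero_iff_of_nonneg
    (mul_nonneg hβ.le (trace_transpose_mul_self_nonneg _)) (trace_transpose_mul_self_nonneg _),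
    mul_eq_zero_iff_left hβ.ne', trace_transpose_mul_self_eq_zero,
    trace_transpose_mul_self_eq_zero] at h
  simpa [h.1] using h.2

theorem fderiv_metric (β : ℝ) (X u v w : Matrix (Fin n) (Fin p) ℝ) :
    fderiv ℝ (fun Y => metric β Y v w) X u =
      (β - 1) * (((uᵀ * v)ᵀ * (Xᵀ * w)).trace + ((Xᵀ * v)ᵀ * (uᵀ * w)).trace) := by
  simp only [metric_eq]
  have hdiff : Differentiable ℝ fun Y : Matrix (Fin n) (Fin p) ℝ =>
      (vᵀ * w).trace + (β - 1) * ((Yᵀ * v)ᵀ * (Yᵀ * w)).trace :=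
    ContDiff.differentiable (by fun_prop) one_ne_zero
  have hline : HasDerivAt (fun s : ℝ => X + s • u) u 0 := (hasFDerivAt_id X).hasLineDerivAt u
  have hmul (z : Matrix (Fin n) (Fin p) ℝ) :
      HasDerivAt (fun s : ℝ => (X + s • u)ᵀ * z) (uᵀ * z) 0 := by
    simpa using hasDerivAt_matrix_mul (hasDerivAt_matrix_transpose hline) (hasDerivAt_const 0 z)
  have htrace := ((hasDerivAt_matrix_trace (hasDerivAt_matrix_mul
    (hasDerivAt_matrix_transpose (hmul v)) (hmul w))).const_mul (β - 1)).const_add (vᵀ * w).trace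
  refine ((hdiff X).hasFDerivAt.hasLineDerivAt u).unique (htrace.congr_deriv ?_)
  rw [zero_smul, add_zero, trace_add, add_comm]

theorem christoffel_metric {v : Matrix (Fin n) (Fin p) ℝ} (hv : v ∈ tangent X)
    (hη : η ∈ tangent X) :
    christoffel (metric β) X v v η = -(2 * (β - 1)) * (Xᵀ * v * (vᵀ * η)).trace := by
  have hsymm : ((vᵀ * v)ᵀ * (Xᵀ * η)).trace = 0 :=
    trace_mul_eq_zero_of_transpose_eq_neg (by simp) (mem_tangent.1 hη)
  have hswap : (Xᵀ * v * (ηᵀ * v)).trace = -(Xᵀ * v * (vᵀ * η)).trace := by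
    rw [← trace_transpose, transpose_mul, mem_tangent.1 hv, Matrix.mul_neg, trace_neg,
      trace_mul_comm, transpose_mul, transpose_transpose]
  have hcomm : ((ηᵀ * v)ᵀ * (Xᵀ * v)).trace = (Xᵀ * v * (vᵀ * η)).trace := by
    rw [trace_mul_comm, transpose_mul, transpose_transpose]
  have hΓ : christoffel (metric β) X v v η = 1 / 2 * (fderiv ℝ (fun Y => metric β Y v η) X v +
      fderiv ℝ (fun Y => metric β Y v η) X v - fderiv ℝ (fun Y => metric β Y v v) X η) := rfl
  rw [hΓ, fderiv_metric, fderiv_metric, hsymm, hcomm, mem_tangent.1 hv, Matrix.neg_mul,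
    Matrix.neg_mul, trace_neg, trace_neg, hswap]
  ring

end Metric

section GeodesicEquation

open Matrix

variable {n p : ℕ} {β : ℝ} {X v : Matrix (Fin n) (Fin p) ℝ}

/-- The acceleration in `ℝ^{n×p}` of the geodesics of `St_β(n, p)` through `X` with velocity `v`,
so that the geodesic equation becomes an ordinary differential equation on `ℝ^{n×p}`. -/
def accel (β : ℝ) (X v : Matrix (Fin n) (Fin p) ℝ) : Matrix (Fin n) (Fin p) ℝ :=
  X * ((2 * (β - 1)) • (Xᵀ * v * (Xᵀ * v)) - vᵀ * v) - (2 * (β - 1)) • (v * (Xᵀ * v))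

theorem transpose_mul_accel (β : ℝ) (v : Matrix (Fin n) (Fin p) ℝ) (hX : X ∈ stiefel n p) :
    Xᵀ * accel β X v = -(vᵀ * v) := by
  simp only [accel, Matrix.mul_sub, ← Matrix.mul_assoc, mem_stiefel.1 hX, Matrix.one_mul,
    Matrix.mul_smul]
  abel

theorem metric_accel {η : Matrix (Fin n) (Fin p) ℝ} (hX : X ∈ stiefel n p) (hv : v ∈ tangent X)
    (hη : η ∈ tangent X) :
    metric β X (accel β X v) η = 2 * (β - 1) * (Xᵀ * v * (vᵀ * η)).trace := by
  have hA : (Xᵀ * v)ᵀ = -(Xᵀ * v) := mem_tangent.1 hv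
  have hW : (vᵀ * v * (Xᵀ * η)).trace = 0 :=
    trace_mul_eq_zero_of_transpose_eq_neg (by simp) (mem_tangent.1 hη)
  have hAA : (Xᵀ * v * (Xᵀ * v) * (Xᵀ * η)).trace = 0 :=
    trace_mul_eq_zero_of_transpose_eq_neg (by rw [transpose_mul, hA, neg_mul_neg])
      (mem_tangent.1 hη)
  have htr : (accel β X v)ᵀ = ((2 * (β - 1)) • (Xᵀ * v * (Xᵀ * v)) - vᵀ * v) * Xᵀ
      + (2 * (β - 1)) • (Xᵀ * v * vᵀ) := by
    simp only [accel, transpose_sub, transpose_smul, transpose_mul _ (Xᵀ * v), hA,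
      transpose_mul X, transpose_mul vᵀ v, transpose_transpose, neg_mul_neg, Matrix.neg_mul]
    module
  rw [metric_eq, transpose_mul_accel β v hX, transpose_neg, transpose_mul, transpose_transpose, htr]
  simp only [Matrix.add_mul, Matrix.sub_mul, Matrix.neg_mul, Matrix.smul_mul, trace_add, trace_sub,
    trace_neg, trace_smul, Matrix.mul_assoc] at hW hAA ⊢
  simp only [hW, hAA, smul_eq_mul]
  ring

theorem metric_accel_add_christoffel {η : Matrix (Fin n) (Fin p) ℝ} (hX : X ∈ stiefel n p)
    (hv : v ∈ tangent X) (hη : η ∈ tangent X) :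
    metric β X (accel β X v) η + christoffel (metric β) X v v η = 0 := by
  rw [metric_accel hX hv hη, christoffel_metric hv hη]
  ring

/-- The condition on `Xᵀ a` is the second derivative of `γᵀ γ = 1`. -/
theorem eq_accel_of_metric_add_christoffel (hβ : 0 < β) {a : Matrix (Fin n) (Fin p) ℝ}
    (hX : X ∈ stiefel n p) (hv : v ∈ tangent X)
    (ha : Xᵀ * a + vᵀ * v + (vᵀ * v + aᵀ * X) = 0)
    (h : ∀ η ∈ tangent X, metric β X a η + christoffel (metric β) X v v η = 0) :
    a = accel β X v := by
  have hd : a - accel β X v ∈ tangent X := by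
    rw [mem_tangent, eq_neg_iff_add_eq_zero, Matrix.mul_sub, transpose_mul_accel β v hX, ← ha]
    simp only [transpose_sub, transpose_neg, transpose_mul, transpose_transpose]
    abel
  refine sub_eq_zero.1 (eq_zero_of_metric_self_eq_zero hβ hX ?_)
  rw [metric_sub_left]
  linarith [h _ hd, metric_accel_add_christoffel (β := β) hX hv hd]

variable {γ γ' : ℝ → Matrix (Fin n) (Fin p) ℝ}

theorem isGeodesic_of_hasDerivAt (hs : ContDiff ℝ ∞ γ) (hm : ∀ t, γ t ∈ stiefel n p)
    (h : ∀ t, HasDerivAt γ (γ' t) t) (h' : ∀ t, HasDerivAt γ' (accel β (γ t) (γ' t)) t) :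
    IsGeodesic (metric β) (stiefel n p) tangent γ := by
  refine ⟨hs, hm, fun t η hη => ?_⟩
  have hzero := metric_accel_add_christoffel (β := β) (hm t) (mem_tangent_of_hasDerivAt hm (h t)) hη
  rw [← (h' t).deriv, ← show deriv γ = γ' from funext fun t => (h t).deriv] at hzero
  exact hzero

theorem IsGeodesic.hasDerivAt (h : IsGeodesic (metric β) (stiefel n p) tangent γ) (t : ℝ) :
    HasDerivAt γ (deriv γ t) t :=
  (h.smooth.differentiable (by simp) t).hasDerivAt

theorem IsGeodesic.hasDerivAt_deriv (hβ : 0 < β)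
    (h : IsGeodesic (metric β) (stiefel n p) tangent γ) (t : ℝ) :
    HasDerivAt (deriv γ) (accel β (γ t) (deriv γ t)) t := by
  have hγ := h.hasDerivAt
  have hγ' : HasDerivAt (deriv γ) (deriv (deriv γ) t) t :=
    ((h.smooth.iterate_deriv 1).differentiable (by simp) t).hasDerivAt
  have htan (s : ℝ) : deriv γ s ∈ tangent (γ s) := mem_tangent_of_hasDerivAt h.mem (hγ s)
  have hsecond := (hasDerivAt_matrix_mul (hasDerivAt_matrix_transpose (hγ t)) hγ').fun_add
    (hasDerivAt_matrix_mul (hasDerivAt_matrix_transpose hγ') (hγ t))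
  rw [show (fun s => (γ s)ᵀ * deriv γ s + (deriv γ s)ᵀ * γ s) = fun _ => 0 from funext htan]
    at hsecond
  rwa [eq_accel_of_metric_add_christoffel hβ (h.mem t) (htan t)
    (hsecond.unique (hasDerivAt_const t 0)) (h.geodesic_eq t)] at hγ'

theorem contDiff_accel (β : ℝ) : ContDiff ℝ 1
    fun q : Matrix (Fin n) (Fin p) ℝ × Matrix (Fin n) (Fin p) ℝ => accel β q.1 q.2 := by
  unfold accel
  fun_prop

theorem IsGeodesic.eq_of_initial_eq (hβ : 0 < β) {δ : ℝ → Matrix (Fin n) (Fin p) ℝ}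
    (hγ : IsGeodesic (metric β) (stiefel n p) tangent γ)
    (hδ : IsGeodesic (metric β) (stiefel n p) tangent δ) (h₀ : γ 0 = δ 0)
    (h₀' : deriv γ 0 = deriv δ 0) : γ = δ := by
  have h := eq_of_hasDerivAt_of_eq (contDiff_snd.prodMk (contDiff_accel β))
    (fun t => (hγ.hasDerivAt t).prodMk (hγ.hasDerivAt_deriv hβ t))
    (fun t => (hδ.hasDerivAt t).prodMk (hδ.hasDerivAt_deriv hβ t)) (Prod.ext h₀ h₀')
  exact funext fun t => congrArg Prod.fst (congrFun h t)

end GeodesicEquation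

section Equivariance

open Matrix

variable {n p : ℕ} {X : Matrix (Fin n) (Fin p) ℝ} {P : Matrix (Fin n) (Fin n) ℝ}
  {E : Matrix (Fin p) (Fin p) ℝ}

theorem transpose_mul_mul_mul {l m k R : Type*} [Fintype l] [Fintype m] [DecidableEq l]
    [CommRing R] {P : Matrix l l R} (hP : Pᵀ * P = 1) (A B : Matrix l m R) (E : Matrix m k R) :
    (P * A * E)ᵀ * (P * B * E) = Eᵀ * (Aᵀ * B) * E := by
  rw [transpose_mul, transpose_mul, Matrix.mul_assoc P, Matrix.mul_assoc, Matrix.mul_assoc,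
    ← Matrix.mul_assoc Pᵀ, hP, Matrix.one_mul]
  simp only [Matrix.mul_assoc]

theorem mul_mul_mem_stiefel (hP : Pᵀ * P = 1) (hE : Eᵀ * E = 1) (hX : X ∈ stiefel n p) :
    P * X * E ∈ stiefel n p := by
  rw [mem_stiefel, transpose_mul_mul_mul hP, mem_stiefel.1 hX, Matrix.mul_one, hE]

theorem metric_mul_mul (β : ℝ) (hP : Pᵀ * P = 1) (hE : Eᵀ * E = 1)
    (X ξ η : Matrix (Fin n) (Fin p) ℝ) :
    metric β (P * X * E) (P * ξ * E) (P * η * E) = metric β X ξ η := by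
  have hconj (C : Matrix (Fin p) (Fin p) ℝ) : (Eᵀ * C * E).trace = C.trace := by
    rw [trace_mul_cycle, mul_eq_one_comm.1 hE, Matrix.one_mul]
  have hE' : Eᵀᵀ * Eᵀ = 1 := by rw [transpose_transpose, mul_eq_one_comm.1 hE]
  have hmul := transpose_mul_mul_mul hE' (Xᵀ * ξ) (Xᵀ * η) E
  simp only [metric_eq, transpose_mul_mul_mul hP, hmul, hconj]

theorem accel_mul_mul (β : ℝ) (hP : Pᵀ * P = 1) (hE : Eᵀ * E = 1)
    (X v : Matrix (Fin n) (Fin p) ℝ) :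
    accel β (P * X * E) (P * v * E) = P * accel β X v * E := by
  have hE' (C : Matrix (Fin p) (Fin p) ℝ) : E * (Eᵀ * C) = C := by
    rw [← Matrix.mul_assoc, mul_eq_one_comm.1 hE, Matrix.one_mul]
  simp only [accel, transpose_mul_mul_mul hP]
  simp only [Matrix.mul_sub, Matrix.sub_mul, Matrix.mul_smul, Matrix.smul_mul, Matrix.mul_assoc,
    hE']

end Equivariance

section Geodesic

open Matrix NormedSpace

variable {n p : ℕ} {β : ℝ} {X ξ : Matrix (Fin n) (Fin p) ℝ}

/-- The infinitesimal rotation of `ℝⁿ` that drives the geodesic of `St_β(n, p)` starting at `X`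
with velocity `ξ`; at `X = I_{n×p}` and `ξ = [A; H]` it is the matrix `omega`. -/
def generator (β : ℝ) (X : Matrix (Fin n) (Fin p) ℝ) :
    Matrix (Fin n) (Fin p) ℝ →ₗ[ℝ] Matrix (Fin n) (Fin n) ℝ where
  toFun ξ := ξ * Xᵀ - X * ξᵀ + (2 * (β - 1)) • (X * (Xᵀ * ξ) * Xᵀ)
  map_add' ξ η := by
    simp only [Matrix.add_mul, Matrix.mul_add, transpose_add, smul_add]
    abel
  map_smul' c ξ := by
    simp only [Matrix.smul_mul, Matrix.mul_smul, transpose_smul, RingHom.id_apply, smul_add,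
      smul_sub, smul_comm c]

theorem generator_apply (β : ℝ) (X ξ : Matrix (Fin n) (Fin p) ℝ) :
    generator β X ξ = ξ * Xᵀ - X * ξᵀ + (2 * (β - 1)) • (X * (Xᵀ * ξ) * Xᵀ) := rfl

theorem transpose_generator (β : ℝ) (hξ : ξ ∈ tangent X) :
    (generator β X ξ)ᵀ = -generator β X ξ := by
  have hproj : (X * (Xᵀ * ξ) * Xᵀ)ᵀ = -(X * (Xᵀ * ξ) * Xᵀ) := by
    rw [transpose_mul, transpose_mul, mem_tangent.1 hξ, transpose_transpose, Matrix.mul_assoc X,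
      Matrix.neg_mul, Matrix.mul_neg]
  simp only [generator_apply, transpose_add, transpose_sub, transpose_smul, hproj,
    transpose_mul ξ, transpose_mul X ξᵀ, transpose_transpose]
  module

theorem generator_mul (β : ℝ) (hX : X ∈ stiefel n p) (hξ : ξ ∈ tangent X) :
    generator β X ξ * X = ξ + (2 * β - 1) • (X * (Xᵀ * ξ)) := by
  have hξX : ξᵀ * X = -(Xᵀ * ξ) := by
    rw [← mem_tangent.1 hξ, transpose_mul, transpose_transpose]
  simp only [generator_apply, Matrix.add_mul, Matrix.sub_mul, Matrix.smul_mul, Matrix.mul_assoc,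
    mem_stiefel.1 hX, hξX, Matrix.mul_one, Matrix.mul_neg]
  module

theorem generator_mul_self_add (β : ℝ) (X ξ : Matrix (Fin n) (Fin p) ℝ) :
    generator β X ξ * ξ + ξ * ((1 - 2 * β) • (Xᵀ * ξ)) = accel β X ξ := by
  simp only [generator_apply, accel, Matrix.add_mul, Matrix.sub_mul, Matrix.mul_sub,
    Matrix.smul_mul, Matrix.mul_smul, Matrix.mul_assoc]
  module

/-- The geodesic of `St_β(n, p)` starting at `X` with velocity `ξ`. -/
noncomputable def geodesic (β : ℝ) (X ξ : Matrix (Fin n) (Fin p) ℝ) (t : ℝ) :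
    Matrix (Fin n) (Fin p) ℝ :=
  exp (t • generator β X ξ) * X * exp (t • ((1 - 2 * β) • (Xᵀ * ξ)))

theorem geodesic_zero (β : ℝ) (X ξ : Matrix (Fin n) (Fin p) ℝ) : geodesic β X ξ 0 = X := by
  simp [geodesic]

theorem contDiff_geodesic (β : ℝ) (X ξ : Matrix (Fin n) (Fin p) ℝ) {k : WithTop ℕ∞} :
    ContDiff ℝ k (geodesic β X ξ) := by
  unfold geodesic
  fun_prop

theorem hasDerivAt_exp_mul_mul_exp {m k : Type*} [Fintype m] [DecidableEq m] [Fintype k]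
    [DecidableEq k] (G : Matrix m m ℝ) (Z : Matrix m k ℝ) (B : Matrix k k ℝ) (t : ℝ) :
    HasDerivAt (fun s : ℝ => exp (s • G) * Z * exp (s • B))
      (exp (t • G) * (G * Z + Z * B) * exp (t • B)) t := by
  have hG : HasDerivAt (fun s : ℝ => exp (s • G) * Z) (exp (t • G) * G * Z) t := by
    refine (hasDerivAt_matrix_mul (hasDerivAt_exp_smul_const G t)
      (hasDerivAt_const t Z)).congr_deriv ?_
    rw [Matrix.mul_zero, zero_add]
    rfl
  have hB : HasDerivAt (fun s : ℝ => exp (s • B)) (B * exp (t • B)) t :=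
    hasDerivAt_exp_smul_const' B t
  refine (hasDerivAt_matrix_mul hG hB).congr_deriv ?_
  simp only [Matrix.mul_add, Matrix.add_mul, Matrix.mul_assoc, add_comm]

theorem hasDerivAt_geodesic (β : ℝ) (hX : X ∈ stiefel n p) (hξ : ξ ∈ tangent X) (t : ℝ) :
    HasDerivAt (geodesic β X ξ)
      (exp (t • generator β X ξ) * ξ * exp (t • ((1 - 2 * β) • (Xᵀ * ξ)))) t := by
  refine (hasDerivAt_exp_mul_mul_exp _ X _ t).congr_deriv ?_
  have h : generator β X ξ * X + X * ((1 - 2 * β) • (Xᵀ * ξ)) = ξ := by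
    rw [generator_mul β hX hξ, Matrix.mul_smul]
    module
  rw [h]

theorem deriv_geodesic (β : ℝ) (hX : X ∈ stiefel n p) (hξ : ξ ∈ tangent X) (t : ℝ) :
    deriv (geodesic β X ξ) t =
      exp (t • generator β X ξ) * ξ * exp (t • ((1 - 2 * β) • (Xᵀ * ξ))) :=
  (hasDerivAt_geodesic β hX hξ t).deriv

theorem transpose_exp_mul_exp {m : Type*} [Fintype m] [DecidableEq m] {S : Matrix m m ℝ}
    (hS : Sᵀ = -S) : (exp S)ᵀ * exp S = 1 := by
  rw [← exp_transpose, hS, ← Matrix.exp_add_of_commute _ _ (Commute.neg_left (Commute.refl S)),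
    neg_add_cancel, exp_zero]

theorem transpose_exp_smul_generator_mul_self (β : ℝ) (hξ : ξ ∈ tangent X) (t : ℝ) :
    (exp (t • generator β X ξ))ᵀ * exp (t • generator β X ξ) = 1 :=
  transpose_exp_mul_exp (by rw [transpose_smul, transpose_generator β hξ, smul_neg])

theorem transpose_exp_smul_transpose_mul_mul_self (hξ : ξ ∈ tangent X) (s t : ℝ) :
    (exp (t • (s • (Xᵀ * ξ))))ᵀ * exp (t • (s • (Xᵀ * ξ))) = 1 :=
  transpose_exp_mul_exp (by simp only [transpose_smul, mem_tangent.1 hξ, smul_neg])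

theorem isGeodesic_geodesic (β : ℝ) (hX : X ∈ stiefel n p) (hξ : ξ ∈ tangent X) :
    IsGeodesic (metric β) (stiefel n p) tangent (geodesic β X ξ) := by
  have hP := transpose_exp_smul_generator_mul_self β hξ
  have hE := transpose_exp_smul_transpose_mul_mul_self hξ (1 - 2 * β)
  refine isGeodesic_of_hasDerivAt (contDiff_geodesic β X ξ)
    (fun t => mul_mul_mem_stiefel (hP t) (hE t) hX) (hasDerivAt_geodesic β hX hξ) fun t => ?_
  refine (hasDerivAt_exp_mul_mul_exp _ ξ _ t).congr_deriv ?_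
  rw [generator_mul_self_add, geodesic, accel_mul_mul β (hP t) (hE t)]

theorem isGeodesic_and_initial_iff (hβ : 0 < β) (hX : X ∈ stiefel n p) (hξ : ξ ∈ tangent X)
    (c : ℝ → Matrix (Fin n) (Fin p) ℝ) :
    IsGeodesic (metric β) (stiefel n p) tangent c ∧ c 0 = X ∧ deriv c 0 = ξ ↔
      c = geodesic β X ξ := by
  have hgeo := isGeodesic_geodesic β hX hξ
  have hzero := geodesic_zero β X ξ
  have hderiv : deriv (geodesic β X ξ) 0 = ξ := by
    simp [deriv_geodesic β hX hξ]
  constructor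
  · rintro ⟨hc, h₀, h₀'⟩
    exact hc.eq_of_initial_eq hβ hgeo (h₀.trans hzero.symm) (h₀'.trans hderiv.symm)
  · rintro rfl
    exact ⟨hgeo, hzero, hderiv⟩

theorem riemExp_eq_geodesic (hβ : 0 < β) (hX : X ∈ stiefel n p) (ξ : tangent X) :
    riemExp (metric β) (stiefel n p) tangent X ξ = geodesic β X ξ 1 := by
  have hex : ∃ γ, IsGeodesic (metric β) (stiefel n p) tangent γ ∧ γ 0 = X ∧
      deriv γ 0 = (ξ : Matrix (Fin n) (Fin p) ℝ) :=
    ⟨_, (isGeodesic_and_initial_iff hβ hX ξ.2 _).2 rfl⟩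
  refine (dif_pos hex).trans (congrFun ?_ 1)
  exact (isGeodesic_and_initial_iff hβ hX ξ.2 _).1 hex.choose_spec

theorem metricNorm_deriv_geodesic (β : ℝ) (hX : X ∈ stiefel n p) (hξ : ξ ∈ tangent X) (t : ℝ) :
    metricNorm (metric β) (geodesic β X ξ t) (deriv (geodesic β X ξ) t) =
      metricNorm (metric β) X ξ := by
  rw [metricNorm, deriv_geodesic β hX hξ, geodesic,
    metric_mul_mul β (transpose_exp_smul_generator_mul_self β hξ t)
      (transpose_exp_smul_transpose_mul_mul_self hξ _ t), metricNorm]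

theorem curveLength_geodesic (β : ℝ) (hX : X ∈ stiefel n p) (hξ : ξ ∈ tangent X) (a b : ℝ) :
    curveLength (metric β) (geodesic β X ξ) a b = (b - a) * metricNorm (metric β) X ξ := by
  have hspeed := metricNorm_deriv_geodesic β hX hξ
  exact (intervalIntegral.integral_congr fun t _ => hspeed t).trans
    (intervalIntegral.integral_const _)

theorem metricNorm_smul (β t : ℝ) (X ξ : Matrix (Fin n) (Fin p) ℝ) :
    metricNorm (metric β) X (t • ξ) = |t| * metricNorm (metric β) X ξ := by
  have hsq : metric β X (t • ξ) (t • ξ) = t ^ 2 * metric β X ξ ξ := by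
    simp only [metric_eq, transpose_smul, Matrix.mul_smul, Matrix.smul_mul, trace_smul, smul_eq_mul]
    ring
  rw [metricNorm, hsq, Real.sqrt_mul (sq_nonneg t), Real.sqrt_sq_eq_abs, metricNorm]

end Geodesic

section CriticalPoints

variable {E : Type*} [NormedAddCommGroup E] [NormedSpace ℝ E] {g : E → E → E → ℝ} {M : Set E}
  {T : E → Submodule ℝ E} {x : E} {v : T x}

theorem IsCriticalPoint.conjRadiusAt_le (hv : IsCriticalPoint g M T x v) :
    conjRadiusAt g M T x ≤ ENNReal.ofReal (metricNorm g x v) := by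
  refine iSup₂_le fun r hr => le_of_not_gt fun hlt => hr v ?_ hv
  exact (ENNReal.ofReal_lt_coe_iff (Real.sqrt_nonneg _)).1 hlt

theorem IsCriticalPoint.isConjugateAlong (hv : IsCriticalPoint g M T x v) {γ : ℝ → E}
    (hγ : IsGeodesic g M T γ) (h₀ : γ 0 = x) {t : ℝ} (h₀' : (v : E) = t • deriv γ 0) :
    IsConjugateAlong g M T γ t := by
  subst h₀
  exact ⟨hγ, v, h₀', hv⟩

end CriticalPoints

section Wedge

open Matrix NormedSpace

section Algebra

theorem transpose_mul_eq_zero_comm {m k l R : Type*} [Fintype m] [CommRing R] {X : Matrix m k R}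
    {ξ : Matrix m l R} (h : Xᵀ * ξ = 0) : ξᵀ * X = 0 := by
  rw [← transpose_transpose X, ← transpose_mul, h, transpose_zero]

variable {m k R : Type*} [Fintype k] [CommRing R]
  {X ξ : Matrix m k R} {J : Matrix k k R}

/-- The skew-symmetric matrix `Σ ξᵢ ∧ Xᵢ` formed from the columns of `ξ` and `X`. When
`Xᵀ X = 1` and `Xᵀ ξ = 0` it generates the rotation that moves `X` in the direction `ξ`. -/
def wedge (X ξ : Matrix m k R) : Matrix m m R := ξ * Xᵀ - X * ξᵀ

theorem wedge_smul (c : R) (X ξ : Matrix m k R) : wedge X (c • ξ) = c • wedge X ξ := by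
  rw [wedge, wedge, Matrix.smul_mul, transpose_smul, Matrix.mul_smul, smul_sub]

variable [Fintype m]

theorem mul_transpose_mul_self_of_skew (hJ : Jᵀ = -J) (hξJ : ξᵀ * ξ * J = J) :
    J * (ξᵀ * ξ) = J := by
  simpa [transpose_mul, hJ] using congrArg transpose hξJ

theorem wedge_mul_right (hξ : Xᵀ * ξ = 0) : wedge X ξ * ξ = -(X * (ξᵀ * ξ)) := by
  simp only [wedge, Matrix.sub_mul, Matrix.mul_assoc, hξ, Matrix.mul_zero, zero_sub]

theorem transpose_mul_wedge_right (hξ : Xᵀ * ξ = 0) : ξᵀ * wedge X ξ = ξᵀ * ξ * Xᵀ := by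
  simp only [wedge, Matrix.mul_sub, ← Matrix.mul_assoc, transpose_mul_eq_zero_comm hξ,
    Matrix.zero_mul, sub_zero]

variable [DecidableEq k]

theorem mul_transpose_add_mul_transpose_mul {l : Type*} (hX : Xᵀ * X = 1) (hξ : Xᵀ * ξ = 0)
    (A B : Matrix l k R) : (A * Xᵀ + B * ξᵀ) * X = A := by
  rw [Matrix.add_mul, Matrix.mul_assoc, Matrix.mul_assoc, hX, transpose_mul_eq_zero_comm hξ,
    Matrix.mul_one, Matrix.mul_zero, add_zero]

theorem wedge_mul_left (hX : Xᵀ * X = 1) (hξ : Xᵀ * ξ = 0) : wedge X ξ * X = ξ := by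
  simp only [wedge, Matrix.sub_mul, Matrix.mul_assoc, hX, transpose_mul_eq_zero_comm hξ,
    Matrix.mul_one, Matrix.mul_zero, sub_zero]

theorem transpose_mul_wedge (hX : Xᵀ * X = 1) (hξ : Xᵀ * ξ = 0) : Xᵀ * wedge X ξ = -ξᵀ := by
  simp only [wedge, Matrix.mul_sub, ← Matrix.mul_assoc, hX, hξ, Matrix.one_mul, Matrix.zero_mul,
    zero_sub]

theorem wedge_mul_wedge_mul_wedge (hX : Xᵀ * X = 1) (hξ : Xᵀ * ξ = 0) (hξξ : ξ * (ξᵀ * ξ) = ξ) :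
    wedge X ξ * wedge X ξ * wedge X ξ = -wedge X ξ := by
  have hξξ' : ξᵀ * ξ * ξᵀ = ξᵀ := by
    simpa only [transpose_mul, transpose_transpose] using congrArg transpose hξξ
  have hsq : wedge X ξ * wedge X ξ = -(X * (ξᵀ * ξ) * Xᵀ + ξ * ξᵀ) := by
    conv_lhs => arg 2; rw [wedge]
    rw [Matrix.mul_sub, ← Matrix.mul_assoc, ← Matrix.mul_assoc, wedge_mul_left hX hξ,
      wedge_mul_right hξ, Matrix.neg_mul]
    abel
  rw [hsq, Matrix.neg_mul, Matrix.add_mul, Matrix.mul_assoc _ Xᵀ, transpose_mul_wedge hX hξ,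
    Matrix.mul_assoc ξ, transpose_mul_wedge_right hξ, ← Matrix.mul_assoc ξ, hξξ, wedge,
    Matrix.mul_neg, Matrix.mul_assoc X, hξξ']
  abel

theorem commute_wedge (hX : Xᵀ * X = 1) (hξ : Xᵀ * ξ = 0) (hJ : Jᵀ = -J)
    (hξJ : ξᵀ * ξ * J = J) : Commute (wedge X ξ) (X * J * Xᵀ + ξ * J * ξᵀ) := by
  have hleft : wedge X ξ * (X * J * Xᵀ + ξ * J * ξᵀ) = ξ * J * Xᵀ - X * J * ξᵀ := by
    simp only [Matrix.mul_add, ← Matrix.mul_assoc, wedge_mul_left hX hξ, wedge_mul_right hξ,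
      Matrix.neg_mul]
    rw [Matrix.mul_assoc X, Matrix.mul_assoc X, hξJ, sub_eq_add_neg]
  have hright : (X * J * Xᵀ + ξ * J * ξᵀ) * wedge X ξ = ξ * J * Xᵀ - X * J * ξᵀ := by
    simp only [Matrix.add_mul, Matrix.mul_assoc, transpose_mul_wedge hX hξ,
      transpose_mul_wedge_right hξ, Matrix.mul_neg]
    rw [← Matrix.mul_assoc ξᵀ, ← Matrix.mul_assoc J, mul_transpose_mul_self_of_skew hJ hξJ]
    abel
  exact hleft.trans hright.symm

theorem wedge_mul_sub (hX : Xᵀ * X = 1) (hξ : Xᵀ * ξ = 0) (hξJ : ξᵀ * ξ * J = J) :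
    wedge X ξ * (X * J * Xᵀ - ξ * J * ξᵀ) = ξ * J * Xᵀ + X * J * ξᵀ := by
  simp only [Matrix.mul_sub, ← Matrix.mul_assoc, wedge_mul_left hX hξ, wedge_mul_right hξ,
    Matrix.neg_mul]
  rw [Matrix.mul_assoc X, Matrix.mul_assoc X, hξJ, sub_neg_eq_add]

theorem wedge_mul_add (hX : Xᵀ * X = 1) (hξ : Xᵀ * ξ = 0) (hξJ : ξᵀ * ξ * J = J) :
    wedge X ξ * (ξ * J * Xᵀ + X * J * ξᵀ) = -(X * J * Xᵀ - ξ * J * ξᵀ) := by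
  simp only [Matrix.mul_add, ← Matrix.mul_assoc, wedge_mul_left hX hξ, wedge_mul_right hξ,
    Matrix.neg_mul]
  rw [Matrix.mul_assoc X, Matrix.mul_assoc X, hξJ]
  abel

theorem sub_mul_wedge (hX : Xᵀ * X = 1) (hξ : Xᵀ * ξ = 0) (hJ : Jᵀ = -J)
    (hξJ : ξᵀ * ξ * J = J) :
    (X * J * Xᵀ - ξ * J * ξᵀ) * wedge X ξ = -(ξ * J * Xᵀ + X * J * ξᵀ) := by
  simp only [Matrix.sub_mul, Matrix.mul_assoc, transpose_mul_wedge hX hξ,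
    transpose_mul_wedge_right hξ, Matrix.mul_neg]
  rw [← Matrix.mul_assoc ξᵀ, ← Matrix.mul_assoc J, mul_transpose_mul_self_of_skew hJ hξJ]
  abel

theorem add_mul_wedge (hX : Xᵀ * X = 1) (hξ : Xᵀ * ξ = 0) (hJ : Jᵀ = -J)
    (hξJ : ξᵀ * ξ * J = J) :
    (ξ * J * Xᵀ + X * J * ξᵀ) * wedge X ξ = X * J * Xᵀ - ξ * J * ξᵀ := by
  simp only [Matrix.add_mul, Matrix.mul_assoc, transpose_mul_wedge hX hξ,
    transpose_mul_wedge_right hξ, Matrix.mul_neg]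
  rw [← Matrix.mul_assoc ξᵀ, ← Matrix.mul_assoc J, mul_transpose_mul_self_of_skew hJ hξJ]
  abel

end Algebra

variable {m k : Type*} [Fintype m] [DecidableEq m] [Fintype k] [DecidableEq k]
  {X ξ : Matrix m k ℝ} {J : Matrix k k ℝ}

theorem fderiv_exp_smul_wedge_sub (hX : Xᵀ * X = 1) (hξ : Xᵀ * ξ = 0) (hξξ : ξ * (ξᵀ * ξ) = ξ)
    (hJ : Jᵀ = -J) (hξJ : ξᵀ * ξ * J = J) (t : ℝ) :
    fderiv ℝ exp (t • wedge X ξ) (X * J * Xᵀ - ξ * J * ξᵀ) =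
      Real.sinc t • (X * J * Xᵀ - ξ * J * ξᵀ) := by
  refine fderiv_exp_smul_of_anticommute (wedge_mul_wedge_mul_wedge hX hξ hξξ) ?_ ?_ t
  · rw [sub_mul_wedge hX hξ hJ hξJ, wedge_mul_sub hX hξ hξJ]
  · rw [Matrix.mul_assoc, wedge_mul_sub hX hξ hξJ, wedge_mul_add hX hξ hξJ]

theorem fderiv_exp_smul_wedge_add (hX : Xᵀ * X = 1) (hξ : Xᵀ * ξ = 0) (hξξ : ξ * (ξᵀ * ξ) = ξ)
    (hJ : Jᵀ = -J) (hξJ : ξᵀ * ξ * J = J) (t : ℝ) :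
    fderiv ℝ exp (t • wedge X ξ) (ξ * J * Xᵀ + X * J * ξᵀ) =
      Real.sinc t • (ξ * J * Xᵀ + X * J * ξᵀ) := by
  refine fderiv_exp_smul_of_anticommute (wedge_mul_wedge_mul_wedge hX hξ hξξ) ?_ ?_ t
  · rw [add_mul_wedge hX hξ hJ hξJ, wedge_mul_add hX hξ hξJ, neg_neg]
  · rw [Matrix.mul_assoc, wedge_mul_add hX hξ hξJ, Matrix.mul_neg, wedge_mul_sub hX hξ hξJ]

theorem exp_smul_wedge_mul (hX : Xᵀ * X = 1) (hξ : Xᵀ * ξ = 0) (hξξ : ξ * (ξᵀ * ξ) = ξ)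
    (hξJ : ξᵀ * ξ * J = J) (t : ℝ) :
    exp (t • wedge X ξ) * (X * J) = Real.cos t • (X * J) + Real.sin t • (ξ * J) := by
  have hS : wedge X ξ * (X * J) = ξ * J := by rw [← Matrix.mul_assoc, wedge_mul_left hX hξ]
  have hSS : wedge X ξ * (ξ * J) = -(X * J) := by
    rw [← Matrix.mul_assoc, wedge_mul_right hξ, Matrix.neg_mul, Matrix.mul_assoc, hξJ]
  have hexp : exp (t • wedge X ξ) = _ :=
    exp_smul_of_cube_eq_neg (wedge_mul_wedge_mul_wedge hX hξ hξξ) t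
  rw [hexp]
  simp only [Matrix.add_mul, Matrix.smul_mul, Matrix.one_mul, Matrix.mul_assoc, hS, hSS]
  module

end Wedge

section Kernel

open Matrix NormedSpace

variable {n p : ℕ} {β : ℝ} {X ξ : Matrix (Fin n) (Fin p) ℝ} {J : Matrix (Fin p) (Fin p) ℝ}

theorem generator_of_transpose_mul_eq_zero (β : ℝ) (hξ : Xᵀ * ξ = 0) :
    generator β X ξ = wedge X ξ := by
  simp only [generator_apply, wedge, hξ, Matrix.mul_zero, Matrix.zero_mul, smul_zero, add_zero]

theorem generator_mul_right (β : ℝ) (hξ : Xᵀ * ξ = 0) (hJ : Jᵀ = -J) :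
    generator β X (ξ * J) = ξ * J * Xᵀ + X * J * ξᵀ := by
  have hξJ : Xᵀ * (ξ * J) = 0 := by rw [← Matrix.mul_assoc, hξ, Matrix.zero_mul]
  rw [generator_of_transpose_mul_eq_zero β hξJ, wedge, transpose_mul, hJ, Matrix.neg_mul,
    Matrix.mul_neg, sub_neg_eq_add, Matrix.mul_assoc X]

theorem generator_mul_left (β : ℝ) (hX : Xᵀ * X = 1) (hJ : Jᵀ = -J) :
    generator β X (X * J) = (2 * β) • (X * J * Xᵀ) := by
  rw [generator_apply, transpose_mul, hJ, Matrix.neg_mul, Matrix.mul_neg, ← Matrix.mul_assoc Xᵀ,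
    hX, Matrix.one_mul, ← Matrix.mul_assoc X]
  module

theorem contDiff_geodesic_velocity (β : ℝ) (X : Matrix (Fin n) (Fin p) ℝ) (t : ℝ)
    {k : WithTop ℕ∞} : ContDiff ℝ k fun ζ => geodesic β X ζ t := by
  simp only [geodesic, generator_apply]
  fun_prop

theorem fderiv_geodesic_velocity (β : ℝ) (X : Matrix (Fin n) (Fin p) ℝ) (hξ : Xᵀ * ξ = 0)
    (w : Matrix (Fin n) (Fin p) ℝ) :
    fderiv ℝ (fun ζ => geodesic β X ζ 1) ξ w =
      fderiv ℝ exp (wedge X ξ) (generator β X w) * X +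
        (1 - 2 * β) • (exp (wedge X ξ) * (X * (Xᵀ * w))) := by
  have hline : HasLineDerivAt ℝ (fun ζ => geodesic β X ζ 1)
      (fderiv ℝ exp (wedge X ξ) (generator β X w) * X +
        (1 - 2 * β) • (exp (wedge X ξ) * (X * (Xᵀ * w)))) ξ w := by
    have hlin : HasDerivAt (fun s : ℝ => generator β X (ξ + s • w)) (generator β X w) 0 := by
      simp only [map_add, map_smul]
      exact (((hasDerivAt_id 0).smul_const _).const_add _).congr_deriv (one_smul ℝ _)
    have hG : HasDerivAt (fun s : ℝ => exp (generator β X (ξ + s • w)))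
        (fderiv ℝ exp (wedge X ξ) (generator β X w)) 0 :=
      (hasFDerivAt_exp _).comp_hasDerivAt_of_eq 0 hlin
        (by simp [generator_of_transpose_mul_eq_zero β hξ])
    have hB : HasDerivAt (fun s : ℝ => exp (s • ((1 - 2 * β) • (Xᵀ * w))))
        ((1 - 2 * β) • (Xᵀ * w)) 0 :=
      (hasDerivAt_exp_smul_const _ (0 : ℝ)).congr_deriv (by simp)
    have h := hasDerivAt_matrix_mul (hasDerivAt_matrix_mul hG (hasDerivAt_const 0 X)) hB
    have hfun : (fun s : ℝ => geodesic β X (ξ + s • w) 1) = fun s : ℝ =>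
        exp (generator β X (ξ + s • w)) * X * exp (s • ((1 - 2 * β) • (Xᵀ * w))) := by
      funext s
      rw [geodesic, one_smul, one_smul, Matrix.mul_add, hξ, zero_add, Matrix.mul_smul, smul_comm s]
    rw [HasLineDerivAt, hfun]
    refine h.congr_deriv ?_
    simp only [zero_smul, add_zero, exp_zero, Matrix.mul_one, Matrix.mul_zero, zero_add,
      Matrix.mul_smul, Matrix.mul_assoc, generator_of_transpose_mul_eq_zero β hξ]
    abel
  exact (((contDiff_geodesic_velocity β X 1).differentiable one_ne_zero
    ξ).hasFDerivAt.hasLineDerivAt w).unique hline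

theorem fderiv_geodesic_mul_left (β : ℝ) (hX : Xᵀ * X = 1) (hξ : Xᵀ * ξ = 0)
    (hξξ : ξ * (ξᵀ * ξ) = ξ) (hJ : Jᵀ = -J) (hξJ : ξᵀ * ξ * J = J) (t : ℝ) :
    fderiv ℝ (fun ζ => geodesic β X ζ 1) (t • ξ) (X * J) =
      ((1 - β) * Real.cos t + β * Real.sinc t) • (X * J) + ((1 - β) * Real.sin t) • (ξ * J) := by
  have htξ : Xᵀ * (t • ξ) = 0 := by rw [Matrix.mul_smul, hξ, smul_zero]
  have hdecomp : generator β X (X * J) =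
      β • ((X * J * Xᵀ + ξ * J * ξᵀ) + (X * J * Xᵀ - ξ * J * ξᵀ)) := by
    rw [generator_mul_left β hX hJ]
    module
  have hcomm : fderiv ℝ exp (t • wedge X ξ) (X * J * Xᵀ + ξ * J * ξᵀ) =
      exp (t • wedge X ξ) * (X * J * Xᵀ + ξ * J * ξᵀ) :=
    fderiv_exp_of_commute ((commute_wedge hX hξ hJ hξJ).smul_left t)
  have hanti := fderiv_exp_smul_wedge_sub hX hξ hξξ hJ hξJ t
  have hproj : (X * J * Xᵀ + ξ * J * ξᵀ) * X = X * J :=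
    mul_transpose_add_mul_transpose_mul hX hξ _ _
  have hproj' : (X * J * Xᵀ - ξ * J * ξᵀ) * X = X * J := by
    rw [sub_eq_add_neg, ← Matrix.neg_mul, mul_transpose_add_mul_transpose_mul hX hξ]
  rw [fderiv_geodesic_velocity β X htξ, wedge_smul, hdecomp, map_smul, map_add, hcomm, hanti,
    Matrix.smul_mul, Matrix.add_mul, Matrix.mul_assoc (exp _), hproj, Matrix.smul_mul, hproj',
    ← Matrix.mul_assoc Xᵀ, hX, Matrix.one_mul, exp_smul_wedge_mul hX hξ hξξ hξJ]
  module

theorem fderiv_geodesic_mul_right (β : ℝ) (hX : Xᵀ * X = 1) (hξ : Xᵀ * ξ = 0)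
    (hξξ : ξ * (ξᵀ * ξ) = ξ) (hJ : Jᵀ = -J) (hξJ : ξᵀ * ξ * J = J) (t : ℝ) :
    fderiv ℝ (fun ζ => geodesic β X ζ 1) (t • ξ) (ξ * J) = Real.sinc t • (ξ * J) := by
  have htξ : Xᵀ * (t • ξ) = 0 := by rw [Matrix.mul_smul, hξ, smul_zero]
  rw [fderiv_geodesic_velocity β X htξ, wedge_smul, generator_mul_right β hξ hJ,
    fderiv_exp_smul_wedge_add hX hξ hξξ hJ hξJ, Matrix.smul_mul,
    mul_transpose_add_mul_transpose_mul hX hξ, ← Matrix.mul_assoc Xᵀ, hξ,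
    Matrix.zero_mul, Matrix.mul_zero, Matrix.mul_zero, smul_zero, add_zero]

theorem isCriticalPoint_of_fderiv_geodesic_eq_zero (hβ : 0 < β) (hX : X ∈ stiefel n p)
    {v w : Matrix (Fin n) (Fin p) ℝ} (hv : v ∈ tangent X) (hw : w ∈ tangent X) (hw0 : w ≠ 0)
    (hderiv : fderiv ℝ (fun ζ => geodesic β X ζ 1) v w = 0) :
    IsCriticalPoint (metric β) (stiefel n p) tangent X ⟨v, hv⟩ := by
  have hexp : riemExp (metric β) (stiefel n p) tangent X =
      (fun ζ => geodesic β X ζ 1) ∘ (tangent X).subtypeL :=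
    funext fun ξ => riemExp_eq_geodesic hβ hX ξ
  have hsmooth : DifferentiableAt ℝ (fun ζ => geodesic β X ζ 1) v :=
    (contDiff_geodesic_velocity β X 1).differentiable one_ne_zero v
  refine ⟨_, hexp ▸ hsmooth.hasFDerivAt.comp _ (tangent X).subtypeL.hasFDerivAt, fun hinj => ?_⟩
  have hker : (⟨w, hw⟩ : tangent X) = 0 := hinj (hderiv.trans (map_zero _).symm)
  exact hw0 (congrArg Subtype.val hker)

theorem isCriticalPoint_smul_of_mem_rootSet (hβ : 0 < β) (hX : X ∈ stiefel n p)
    (hξ : Xᵀ * ξ = 0) (hξξ : ξ * (ξᵀ * ξ) = ξ) (hJ : Jᵀ = -J) (hξJ : ξᵀ * ξ * J = J) (hJ0 : J ≠ 0)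
    {t : ℝ} (ht : t ∈ rootSet β) (htξ : t • ξ ∈ tangent X) :
    IsCriticalPoint (metric β) (stiefel n p) tangent X ⟨t • ξ, htξ⟩ := by
  have hX' := mem_stiefel.1 hX
  obtain ⟨htpos, hroot⟩ := (mem_rootSet_iff hβ.ne').1 ht
  let w := X * J - ((1 - β) * t) • (ξ * J)
  have hXw : Xᵀ * w = J := by
    rw [Matrix.mul_sub, Matrix.mul_smul, ← Matrix.mul_assoc, ← Matrix.mul_assoc, hX', hξ,
      Matrix.one_mul, Matrix.zero_mul, smul_zero, sub_zero]
  have hw : w ∈ tangent X := mem_tangent.2 (by rw [hXw, hJ])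
  have hw0 : w ≠ 0 := fun h => hJ0 (by rw [← hXw, h, Matrix.mul_zero])
  have hcos : (1 - β) * Real.cos t + β * Real.sinc t = 0 := by
    rw [rootFun] at hroot
    rw [Real.sinc_of_ne_zero htpos.ne']
    field_simp
    linarith
  have hsin : (1 - β) * Real.sin t - (1 - β) * t * Real.sinc t = 0 := by
    rw [Real.sinc_of_ne_zero htpos.ne']
    field_simp
    ring
  refine isCriticalPoint_of_fderiv_geodesic_eq_zero hβ hX htξ hw hw0 ?_
  rw [map_sub, map_smul, fderiv_geodesic_mul_left β hX' hξ hξξ hJ hξJ,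
    fderiv_geodesic_mul_right β hX' hξ hξξ hJ hξJ, hcos, zero_smul, zero_add, smul_smul, ← sub_smul,
    hsin, zero_smul]

theorem isCriticalPoint_smul_of_sinc_eq_zero (hβ : 0 < β) (hX : X ∈ stiefel n p)
    (hξ : Xᵀ * ξ = 0) (hξξ : ξ * (ξᵀ * ξ) = ξ) (hJ : Jᵀ = -J) (hξJ : ξᵀ * ξ * J = J) (hJ0 : J ≠ 0)
    {t : ℝ} (ht : Real.sinc t = 0) (htξ : t • ξ ∈ tangent X) :
    IsCriticalPoint (metric β) (stiefel n p) tangent X ⟨t • ξ, htξ⟩ := by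
  have hw : ξ * J ∈ tangent X := by
    rw [mem_tangent, ← Matrix.mul_assoc, hξ, Matrix.zero_mul, transpose_zero, neg_zero]
  have hw0 : ξ * J ≠ 0 := fun h => hJ0 (by rw [← hξJ, Matrix.mul_assoc, h, Matrix.mul_zero])
  refine isCriticalPoint_of_fderiv_geodesic_eq_zero hβ hX htξ hw hw0 ?_
  rw [fderiv_geodesic_mul_right β (mem_stiefel.1 hX) hξ hξξ hJ hξJ, ht, zero_smul]

end Kernel

section Blocks

open Matrix NormedSpace

variable {n p : ℕ} {Q : Matrix (Fin n) (Fin n) ℝ} {A : Matrix (Fin p) (Fin p) ℝ}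

theorem transpose_mul_self_of_mem_orthogonalGroup (hQ : Q ∈ orthogonalGroup (Fin n) ℝ) :
    Qᵀ * Q = 1 :=
  (mem_orthogonalGroup_iff' (Fin n) ℝ).1 hQ

theorem stack_mul (h : p ≤ n) (A B : Matrix (Fin p) (Fin p) ℝ)
    (H : Matrix (Fin (n - p)) (Fin p) ℝ) : stack h A H * B = stack h (A * B) (H * B) := by
  rw [stack, stack, ← fromRows_mul]
  rfl

theorem stack_mul_transpose_stack (h : p ≤ n) (A B : Matrix (Fin p) (Fin p) ℝ)
    (H K : Matrix (Fin (n - p)) (Fin p) ℝ) :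
    stack h A H * (stack h B K)ᵀ = Matrix.reindex (split h) (split h)
      (fromBlocks (A * Bᵀ) (A * Kᵀ) (H * Bᵀ) (H * Kᵀ)) := by
  rw [stack, stack, reindex_apply, reindex_apply, transpose_submatrix, submatrix_mul_equiv,
    transpose_fromRows, fromRows_mul_fromCols, reindex_apply]

theorem transpose_mul_stack_mul_mul_stack (h : p ≤ n) (hQ : Q ∈ orthogonalGroup (Fin n) ℝ)
    (A B : Matrix (Fin p) (Fin p) ℝ) (H K : Matrix (Fin (n - p)) (Fin p) ℝ) :
    (Q * stack h A H)ᵀ * (Q * stack h B K) = Aᵀ * B + Hᵀ * K := by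
  rw [transpose_mul, Matrix.mul_assoc, ← Matrix.mul_assoc Qᵀ,
    transpose_mul_self_of_mem_orthogonalGroup hQ, Matrix.one_mul, stack, stack,
    reindex_apply, reindex_apply, transpose_submatrix, submatrix_mul_equiv, transpose_fromRows,
    fromCols_mul_fromRows, Equiv.refl_symm, Equiv.coe_refl, submatrix_id_id]

theorem transpose_mul_frame_mul_mul_stack (h : p ≤ n) (hQ : Q ∈ orthogonalGroup (Fin n) ℝ)
    (A : Matrix (Fin p) (Fin p) ℝ) (H : Matrix (Fin (n - p)) (Fin p) ℝ) :
    (Q * frame h)ᵀ * (Q * stack h A H) = A := by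
  rw [frame, transpose_mul_stack_mul_mul_stack h hQ, transpose_one, transpose_zero, Matrix.one_mul,
    Matrix.zero_mul, add_zero]

theorem mul_frame_mem_stiefel (h : p ≤ n) (hQ : Q ∈ orthogonalGroup (Fin n) ℝ) :
    Q * frame h ∈ stiefel n p :=
  mem_stiefel.2 (transpose_mul_frame_mul_mul_stack h hQ 1 0)

theorem mul_stack_mem_tangent (h : p ≤ n) (hQ : Q ∈ orthogonalGroup (Fin n) ℝ) (hA : Aᵀ = -A)
    (H : Matrix (Fin (n - p)) (Fin p) ℝ) : Q * stack h A H ∈ tangent (Q * frame h) := by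
  rw [mem_tangent, transpose_mul_frame_mul_mul_stack h hQ, hA]

theorem generator_mul_mul (hQ : Q ∈ orthogonalGroup (Fin n) ℝ) (β : ℝ)
    (X ξ : Matrix (Fin n) (Fin p) ℝ) :
    generator β (Q * X) (Q * ξ) = Q * generator β X ξ * Qᵀ := by
  have hXξ : (Q * X)ᵀ * (Q * ξ) = Xᵀ * ξ := by
    rw [transpose_mul, Matrix.mul_assoc, ← Matrix.mul_assoc Qᵀ,
      transpose_mul_self_of_mem_orthogonalGroup hQ, Matrix.one_mul]
  simp only [generator_apply, hXξ]
  simp only [transpose_mul, Matrix.mul_add, Matrix.mul_sub, Matrix.add_mul, Matrix.sub_mul,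
    Matrix.mul_smul, Matrix.smul_mul, Matrix.mul_assoc]

theorem generator_frame (h : p ≤ n) (β : ℝ) (hA : Aᵀ = -A)
    (H : Matrix (Fin (n - p)) (Fin p) ℝ) :
    generator β (frame h) (stack h A H) = omega h β A H := by
  have hproj : (frame h)ᵀ * stack h A H = A := by
    simpa only [Matrix.one_mul] using
      transpose_mul_frame_mul_mul_stack h (one_mem (orthogonalGroup (Fin n) ℝ)) A H
  have htop : A - Aᵀ + (2 * (β - 1)) • A = (2 * β) • A := by
    rw [hA]
    module
  rw [generator_apply, hproj, frame, stack_mul, stack_mul_transpose_stack,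
    stack_mul_transpose_stack, stack_mul_transpose_stack, omega]
  simp only [reindex_apply, transpose_one, transpose_zero, Matrix.one_mul, Matrix.mul_one,
    Matrix.zero_mul, Matrix.mul_zero]
  have hblocks : fromBlocks A 0 H 0 - fromBlocks Aᵀ Hᵀ 0 0 +
      (2 * (β - 1)) • fromBlocks A 0 0 0 = fromBlocks ((2 * β) • A) (-Hᵀ) H 0 := by
    rw [sub_eq_add_neg, fromBlocks_neg, fromBlocks_add, fromBlocks_smul, fromBlocks_add,
      ← sub_eq_add_neg A, htop]
    simp only [neg_zero, smul_zero, add_zero, zero_add]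
  rw [← hblocks]
  rfl

theorem geodesic_mul_frame (h : p ≤ n) (β : ℝ) (hQ : Q ∈ orthogonalGroup (Fin n) ℝ)
    (hA : Aᵀ = -A) (H : Matrix (Fin (n - p)) (Fin p) ℝ) (t : ℝ) :
    geodesic β (Q * frame h) (Q * stack h A H) t =
      Q * exp (t • omega h β A H) * frame h * exp (t • ((1 - 2 * β) • A)) := by
  have hQ' := transpose_mul_self_of_mem_orthogonalGroup hQ
  have hinv : Q⁻¹ = Qᵀ := inv_eq_left_inv hQ'
  have hexp : exp (t • (Q * omega h β A H * Qᵀ)) = Q * exp (t • omega h β A H) * Qᵀ := by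
    rw [← hinv, ← Matrix.exp_conj _ _ (.of_mul_eq_one_right _ hQ'), Matrix.mul_smul,
      Matrix.smul_mul]
  rw [geodesic, generator_mul_mul hQ, generator_frame h β hA, hexp,
    transpose_mul_frame_mul_mul_stack h hQ, Matrix.mul_assoc (Q * _), ← Matrix.mul_assoc Qᵀ, hQ',
    Matrix.one_mul]

theorem exists_orthogonalGroup_submatrix_eq {m k : Type*} [Fintype m] [DecidableEq m]
    [DecidableEq k] (e : k ↪ m) {X : Matrix m k ℝ} (hX : Xᵀ * X = 1) :
    ∃ Q ∈ orthogonalGroup m ℝ, Q.submatrix id e = X := by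
  let v : m → EuclideanSpace ℝ m := Function.extend e (fun j => WithLp.toLp 2 fun i => X i j) 0
  have hve (j : k) : v (e j) = WithLp.toLp 2 fun i => X i j := e.injective.extend_apply _ _ j
  have hv : Orthonormal ℝ ((Set.range e).domRestrict v) := by
    rw [orthonormal_iff_ite]
    rintro ⟨_, i, rfl⟩ ⟨_, j, rfl⟩
    have hij := congrFun₂ hX i j
    rw [mul_apply, one_apply] at hij
    simp only [Set.domRestrict_apply, hve, PiLp.inner_apply]
    refine (Finset.sum_congr rfl fun _ _ => mul_comm _ _).trans (hij.trans (if_congr ?_ rfl rfl))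
    exact (Subtype.ext_iff.trans (e.apply_eq_iff_eq i j)).symm
  obtain ⟨b, hb⟩ := hv.exists_orthonormalBasis_extension_of_card_eq (by simp)
  refine ⟨of fun i j => b j i, ?_, ?_⟩
  · rw [mem_orthogonalGroup_iff']
    ext i j
    rw [one_apply, ← orthonormal_iff_ite.1 b.orthonormal i j]
    exact Finset.sum_congr rfl fun _ _ => mul_comm _ _
  · ext i j
    rw [submatrix_apply, of_apply, hb _ ⟨j, rfl⟩, hve]
    rfl

theorem mul_frame_eq_submatrix (h : p ≤ n) (Q : Matrix (Fin n) (Fin n) ℝ) :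
    Q * frame h = Q.submatrix id (split h ∘ Sum.inl) := by
  ext i j
  rw [mul_apply, ← (split h).sum_comp, Fintype.sum_sum_type]
  simp [frame, stack, one_apply]

theorem exists_eq_mul_frame (h : p ≤ n) {X : Matrix (Fin n) (Fin p) ℝ} (hX : X ∈ stiefel n p) :
    ∃ Q ∈ orthogonalGroup (Fin n) ℝ, X = Q * frame h := by
  obtain ⟨Q, hQ, hQX⟩ := exists_orthogonalGroup_submatrix_eq
    (Function.Embedding.inl.trans (split h).toEmbedding) (mem_stiefel.1 hX)
  exact ⟨Q, hQ, by rw [mul_frame_eq_submatrix, ← hQX]; rfl⟩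

end Blocks

section HMat

open Matrix

variable {n p : ℕ}

theorem transpose_hMat_mul (hn : p + 2 ≤ n) :
    (hMat n p)ᵀ * hMat n p = diagonal fun i : Fin p => if (i : ℕ) < 2 then 1 else 0 := by
  ext i j
  rw [mul_apply, diagonal_apply]
  simp only [transpose_apply, hMat, of_apply]
  by_cases hi : (i : ℕ) < 2
  · rw [Finset.sum_eq_single (⟨i, by omega⟩ : Fin (n - p))]
    · grind
    · grind
    · simp
  · simp [hi]

theorem hMat_mul_transpose_mul (hn : p + 2 ≤ n) :
    hMat n p * ((hMat n p)ᵀ * hMat n p) = hMat n p := by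
  rw [transpose_hMat_mul hn]
  ext i j
  rw [mul_diagonal]
  simp only [hMat, of_apply]
  grind

theorem trace_transpose_hMat_mul (hp : 2 ≤ p) (hn : p + 2 ≤ n) :
    ((hMat n p)ᵀ * hMat n p).trace = 2 := by
  rw [transpose_hMat_mul hn, trace_diagonal, Finset.sum_boole, Fin.card_filter_val_lt,
    min_eq_right hp, Nat.cast_ofNat]

/-- The infinitesimal rotation of the first two coordinates of `ℝᵖ`. It is the skew-symmetric
matrix fixed by `HᵀH` from which the kernel vectors of the derivative of `Exp` are built. -/
def rotation (p : ℕ) : Matrix (Fin p) (Fin p) ℝ :=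
  of fun i j => if (i : ℕ) = 1 ∧ (j : ℕ) = 0 then 1
    else if (i : ℕ) = 0 ∧ (j : ℕ) = 1 then -1 else 0

theorem transpose_rotation (p : ℕ) : (rotation p)ᵀ = -rotation p := by
  ext i j
  rw [transpose_apply, neg_apply, rotation, of_apply, of_apply]
  grind

theorem rotation_ne_zero (hp : 2 ≤ p) : rotation p ≠ 0 := by
  intro h
  have hentry := congrFun₂ h ⟨1, by omega⟩ ⟨0, by omega⟩
  simp [rotation] at hentry

theorem transpose_hMat_mul_mul_rotation (hn : p + 2 ≤ n) :
    (hMat n p)ᵀ * hMat n p * rotation p = rotation p := by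
  rw [transpose_hMat_mul hn]
  ext i j
  rw [diagonal_mul]
  simp only [rotation, of_apply]
  grind

theorem metricNorm_mul_stack_hMat (hp : 2 ≤ p) (hn : p + 2 ≤ n) (h : p ≤ n) (β : ℝ)
    {Q : Matrix (Fin n) (Fin n) ℝ} (hQ : Q ∈ orthogonalGroup (Fin n) ℝ) :
    metricNorm (metric β) (Q * frame h) (Q * stack h 0 (hMat n p)) = √2 := by
  rw [metricNorm, metric_apply h β Q hQ, trace_transpose_hMat_mul hp hn, Matrix.mul_zero,
    trace_zero, mul_zero, zero_add]

theorem isCriticalPoint_smul_mul_stack_hMat {β : ℝ} (hβ : 0 < β) (hp : 2 ≤ p) (hn : p + 2 ≤ n)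
    (h : p ≤ n) {Q : Matrix (Fin n) (Fin n) ℝ} (hQ : Q ∈ orthogonalGroup (Fin n) ℝ) {t : ℝ}
    (ht : t ∈ rootSet β ∨ Real.sinc t = 0)
    (hmem : t • (Q * stack h 0 (hMat n p)) ∈ tangent (Q * frame h)) :
    IsCriticalPoint (metric β) (stiefel n p) tangent (Q * frame h) ⟨_, hmem⟩ := by
  have hX := mul_frame_mem_stiefel h hQ
  have hξ := transpose_mul_frame_mul_mul_stack h hQ 0 (hMat n p)
  have hsq : (Q * stack h 0 (hMat n p))ᵀ * (Q * stack h 0 (hMat n p)) =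
      (hMat n p)ᵀ * hMat n p := by
    rw [transpose_mul_stack_mul_mul_stack h hQ, Matrix.mul_zero, zero_add]
  have hξξ : Q * stack h 0 (hMat n p) *
      ((Q * stack h 0 (hMat n p))ᵀ * (Q * stack h 0 (hMat n p))) = Q * stack h 0 (hMat n p) := by
    rw [hsq, Matrix.mul_assoc, stack_mul, hMat_mul_transpose_mul hn, Matrix.zero_mul]
  have hξJ : (Q * stack h 0 (hMat n p))ᵀ * (Q * stack h 0 (hMat n p)) * rotation p =
      rotation p := by
    rw [hsq, transpose_hMat_mul_mul_rotation hn]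
  have hJ := transpose_rotation p
  have hJ0 := rotation_ne_zero hp
  rcases ht with ht | ht
  · exact isCriticalPoint_smul_of_mem_rootSet hβ hX hξ hξξ hJ hξJ hJ0 ht hmem
  · exact isCriticalPoint_smul_of_sinc_eq_zero hβ hX hξ hξξ hJ hξJ hJ0 ht hmem

theorem conjRadiusAt_le {β : ℝ} (hβ : 0 < β) (hp : 2 ≤ p) (hn : p + 2 ≤ n)
    {X : Matrix (Fin n) (Fin p) ℝ} (hX : X ∈ stiefel n p) {t : ℝ}
    (ht : t ∈ rootSet β ∨ Real.sinc t = 0) :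
    conjRadiusAt (metric β) (stiefel n p) tangent X ≤ ENNReal.ofReal (|t| * √2) := by
  have h : p ≤ n := by omega
  obtain ⟨Q, hQ, rfl⟩ := exists_eq_mul_frame h hX
  have htan : Q * stack h 0 (hMat n p) ∈ tangent (Q * frame h) :=
    mul_stack_mem_tangent h hQ (by rw [transpose_zero, neg_zero]) _
  have hcrit := isCriticalPoint_smul_mul_stack_hMat hβ hp hn h hQ ht (Submodule.smul_mem _ t htan)
  rw [← metricNorm_mul_stack_hMat hp hn h β hQ, ← metricNorm_smul]
  exact hcrit.conjRadiusAt_le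

theorem conjRadiusAt_le_min {β : ℝ} (hβ : 0 < β) (hp : 2 ≤ p) (hn : p + 2 ≤ n)
    {X : Matrix (Fin n) (Fin p) ℝ} (hX : X ∈ stiefel n p) :
    conjRadiusAt (metric β) (stiefel n p) tangent X ≤
      ENNReal.ofReal (min (tRoot β) Real.pi * √2) := by
  have hroot := (isLeast_tRoot hβ).1
  rcases min_choice (tRoot β) Real.pi with h | h <;> rw [h]
  · simpa only [abs_of_pos hroot.1] using conjRadiusAt_le hβ hp hn hX (.inl hroot)
  · simpa only [abs_of_pos Real.pi_pos] using conjRadiusAt_le hβ hp hn hX (.inr sinc_pi)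

end HMat

end StiefelConj

open StiefelConj in
theorem theorem5p1 (n p : ℕ) (hp : 2 ≤ p) (hn : p + 2 ≤ n) (hpn : p ≤ n) (β : ℝ) (hβ : 0 < β)
    (Q : Matrix (Fin n) (Fin n) ℝ) (hQ : Q ∈ Matrix.orthogonalGroup (Fin n) ℝ)
    (ξ : Matrix (Fin n) (Fin p) ℝ) (hξ : ξ = Q * stack hpn 0 (hMat n p))
    (γ : ℝ → Matrix (Fin n) (Fin p) ℝ)
    (hγ : γ = fun t => Q * NormedSpace.exp (t • omega hpn β 0 (hMat n p)) * frame hpn) :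
    -- the set of positive roots has a smallest element, `tRoot β`
    IsLeast (rootSet β) (tRoot β) ∧
    -- `γ` is the geodesic starting at `Q I_{n×p}` in the direction of the tangent vector `ξ`
    (Q * frame hpn ∈ stiefel n p ∧ ξ ∈ tangent (Q * frame hpn) ∧
      ∀ c : ℝ → Matrix (Fin n) (Fin p) ℝ,
        (IsGeodesic (metric β) (stiefel n p) tangent c ∧ c 0 = Q * frame hpn ∧ deriv c 0 = ξ)
          ↔ c = γ) ∧
    -- conjugate points
    IsConjugateAlong (metric β) (stiefel n p) tangent γ (tRoot β) ∧
    IsConjugateAlong (metric β) (stiefel n p) tangent γ Real.pi ∧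
    -- speed and length
    (∀ t, metricNorm (metric β) (γ t) (deriv γ t) = √2) ∧
    (∀ T > 0, curveLength (metric β) γ 0 T = T * √2) ∧
    -- conjugate radius, at every point and of the manifold
    (∀ X ∈ stiefel n p, conjRadiusAt (metric β) (stiefel n p) tangent X ≤
      ENNReal.ofReal (min (tRoot β) Real.pi * √2)) ∧
    conjRadius (metric β) (stiefel n p) tangent ≤
      ENNReal.ofReal (min (tRoot β) Real.pi * √2) ∧
    (β ≤ 1 → min (tRoot β) Real.pi = tRoot β) ∧
    (1 ≤ β → min (tRoot β) Real.pi = Real.pi) := by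
  have hroot := isLeast_tRoot hβ
  have hX := mul_frame_mem_stiefel hpn hQ
  have hzero : (0 : Matrix (Fin p) (Fin p) ℝ)ᵀ = -0 := by simp
  have htan : ξ ∈ tangent (Q * frame hpn) := hξ ▸ mul_stack_mem_tangent hpn hQ hzero _
  have hgeo : γ = geodesic β (Q * frame hpn) ξ := by
    funext t
    simp [hγ, hξ, geodesic_mul_frame hpn β hQ hzero]
  have hiff := isGeodesic_and_initial_iff hβ hX htan
  obtain ⟨hγgeo, hγ0, hγ0'⟩ := (hiff γ).2 hgeo
  have hnorm : metricNorm (metric β) (Q * frame hpn) ξ = √2 :=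
    hξ ▸ metricNorm_mul_stack_hMat hp hn hpn β hQ
  have hconj {t : ℝ} (ht : t ∈ rootSet β ∨ Real.sinc t = 0) :
      IsConjugateAlong (metric β) (stiefel n p) tangent γ t := by
    subst hξ
    exact (isCriticalPoint_smul_mul_stack_hMat hβ hp hn hpn hQ ht
      (Submodule.smul_mem _ t htan)).isConjugateAlong hγgeo hγ0 (congrArg (t • ·) hγ0'.symm)
  refine ⟨hroot, ⟨hX, htan, fun c => (hiff c).trans (by rw [hgeo])⟩, hconj (.inl hroot.1),
    hconj (.inr sinc_pi), fun t => ?_, fun T _ => ?_,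
    fun _ => conjRadiusAt_le_min hβ hp hn, (iInf₂_le _ hX).trans (conjRadiusAt_le_min hβ hp hn hX),
    fun h => min_eq_left (tRoot_le_pi hβ h), fun h => min_eq_right (pi_le_tRoot h)⟩
  · rw [hgeo, metricNorm_deriv_geodesic β hX htan, hnorm]
  · rw [hgeo, curveLength_geodesic β hX htan, hnorm, sub_zero]
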